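/- Let $\mathcal H$ be a complex Hilbert space (possibly infinite dimensional), let $\hbar>0$, and let $\sigma=(p_1,\dots,p_l;m_1,\dots,m_l)$ with $p_1>\dots>p_l>0$, $m_j\ge 1$ and $\sum_j m_jp_j=1$. Let $\mathcal D(\sigma)$ be the set of density operators on $\mathcal H$ of finite rank whose different positive eigenvalues are $p_1,\dots,p_l$, with multiplicities $m_1,\dots,m_l$. Let $\mathcal K$ be a Hilbert space of dimension $k=m_1+\dots+m_l$ with an orthonormal basis split into consecutive blocks of lengths $m_1,\dots,m_l$, let $\Pi_j$ be the orthogonal projection onto the span of the $j$-th block, $P(\sigma)=\sum_j p_j\Pi_j$, and $\mathcal S(\sigma)=\{\psi\in\mathcal L(\mathcal K,\mathcal H):\psi^\dagger\psi=P(\sigma)\}$ with the metric $G(X,Y)=\tfrac12\operatorname{Tr}(X^\dagger Y+Y^\dagger X)$. Equip $\mathcal D(\sigma)$ with the Riemannian metric $g$ that makes $\pi:\mathcal S(\sigma)\to\mathcal D(\sigma)$, $\pi(\psi)=\psi\psi^\dagger$, a Riemannian submersion, that is, $d\pi$ restricts to an isometry on the $G$-orthogonal complement of $\operatorname{Ker}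 d\pi_\psi$ in $T_\psi\mathcal S(\sigma)$ for every $\psi$. For $\rho_0,\rho_1\in\mathcal D(\sigma)$ let $\operatorname{dist}(\rho_0,\rho_1)$ be the infimum of the lengths $\int_0^\tau\sqrt{g(\dot\rho,\dot\rho)}\,dt$ of the $C^1$ curves $\rho:[0,\tau]\to\mathcal D(\sigma)$, $\tau>0$, from $\rho_0$ to $\rho_1$. A Hamiltonian on $[0,\tau]$ is a norm-continuous curve $H=H(t)$, $0\le t\le\tau$, of bounded self-adjoint operators on $\mathcal H$; its uncertainty is $\Delta H(\rho)=\sqrt{\operatorname{Tr}(H^2\rho)-\operatorname{Tr}(H\rho)^2}$. Consider the boundary value von Neumann equation $$i\hbar\,\dot\rho=[H,\rho],\qquad \rho(0)=\rho_0,\quad\rho(\tau)=\rho_1.\tag{1}$$ **Theorem.** For all $\rho_0,\rho_1\in\mathcal D(\sigma)$, $$\operatorname{dist}(\rho_0,\rho_1)=\inf_{H}\frac1\hbar\int_0^\tau\Delta H(\rho)\,dt,$$ where the infimum is over all Hamiltonians $H$ on $[0,\tau]$ for which (1) has a solution $\rho$ (the set of these is not empty); this holds for every fixed $\tau>0$,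 and also if the infimum is taken over all $\tau>0$ together. Moreover, for every $\tau>0$, every Hamiltonian $H$ on $[0,\tau]$ and every solution $\rho$ of (1), if $\Delta E=\frac1\tau\int_0^\tau\Delta H(\rho)\,dt>0$, then $$\tau\ \ge\ \frac{\hbar}{\Delta E}\operatorname{dist}(\rho_0,\rho_1)\ \ge\ \frac{\hbar}{\Delta E}\arccos\sqrt{F(\rho_0,\rho_1)},\qquad F(\rho_0,\rho_1)=\Big(\operatorname{Tr}\sqrt{\sqrt{\rho_0}\,\rho_1\sqrt{\rho_0}}\Big)^2 .$$ -/

import Mathlib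

namespace QuantumSpeed

open ContinuousLinearMap

noncomputable section

/-! ## Density operators and isospectral orbits -/

section Operators

variable {H : Type*} [NormedAddCommGroup H] [InnerProductSpace ℂ H] [CompleteSpace H]

/-- The diagonal coefficients `⟨e, A e⟩` of an operator in an orthonormal (Hilbert) basis of `H`. -/
def diagCoeff (A : H →L[ℂ] H) (e : (exists_hilbertBasis ℂ H).choose) : ℂ :=
  inner ℂ (e : H) (A (e : H))

/-- The trace `Tr A = ∑ₑ ⟨e, A e⟩` over an orthonormal basis of `H`. For trace class operators
(in particular for operators of finite rank) it does not depend on the basis. -/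
def opTrace (A : H →L[ℂ] H) : ℂ := ∑' e, diagCoeff A e

/-- A density operator: a positive operator of trace `1`. -/
structure IsDensityOperator (ρ : H →L[ℂ] H) : Prop where
  isPositive : ρ.IsPositive
  hasSum_diag : HasSum (diagCoeff ρ) 1

end Operators

/-- The spectrum `(p₁, …, p_l; m₁, …, m_l)` of a density operator of finite rank: its different
positive eigenvalues in descending order, and their multiplicities. -/
structure DensitySpectrum where
  l : ℕ
  p : Fin l → ℝ
  m : Fin l → ℕ
  p_pos : ∀ j, 0 < p j
  p_strictAnti : StrictAnti p
  m_pos : ∀ j, 0 < m j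
  sum_eq_one : ∑ j, (m j : ℝ) * p j = 1

/-- `D(σ)`: the density operators on `H` of finite rank that have spectrum `σ`. -/
def isospectral (σ : DensitySpectrum) (H : Type*) [NormedAddCommGroup H] [InnerProductSpace ℂ H]
    [CompleteSpace H] : Set (H →L[ℂ] H) :=
  {ρ | IsDensityOperator ρ ∧
    FiniteDimensional ℂ (LinearMap.range (ρ : H →ₗ[ℂ] H)) ∧
    (∀ x : ℝ, 0 < x → Module.End.HasEigenvalue (ρ : H →ₗ[ℂ] H) (x : ℂ) → ∃ j, x = σ.p j) ∧
    ∀ j, Module.finrank ℂ (Module.End.eigenspace (ρ : H →ₗ[ℂ] H) (σ.p j : ℂ)) = σ.m j}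

/-! ## The bundle of purifications and the metric on the orbit -/

/-- The Hilbert space `K` of dimension `k = m₁ + … + m_l`. Its computational basis is split into
consecutive blocks of lengths `m₁, …, m_l`. -/
abbrev AuxSpace (σ : DensitySpectrum) : Type := EuclideanSpace ℂ (Σ j : Fin σ.l, Fin (σ.m j))

/-- The computational basis of `K`. -/
def ket (σ : DensitySpectrum) (i : Σ j : Fin σ.l, Fin (σ.m j)) : AuxSpace σ :=
  EuclideanSpace.single i 1

/-- `Π_j`, the orthogonal projection of `K` onto the span of the `j`-th block of the basis. -/
def blockProj (σ : DensitySpectrum) (j : Fin σ.l) : AuxSpace σ →L[ℂ] AuxSpace σ :=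
  ∑ i : Fin (σ.m j), InnerProductSpace.rankOne ℂ (ket σ ⟨j, i⟩) (ket σ ⟨j, i⟩)

/-- `P(σ) = ∑ p_j Π_j`. -/
def charOp (σ : DensitySpectrum) : AuxSpace σ →L[ℂ] AuxSpace σ :=
  ∑ j, (σ.p j : ℂ) • blockProj σ j

section Bundle

variable {H : Type*} [NormedAddCommGroup H] [InnerProductSpace ℂ H] [CompleteSpace H]
  {σ : DensitySpectrum}

/-- The real part of the Hilbert-Schmidt inner product, `G(X, Y) = (1/2) Tr(X†Y + Y†X)`. -/
def hsMetric (X Y : AuxSpace σ →L[ℂ] H) : ℝ :=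
  (1 / 2) * (LinearMap.trace ℂ (AuxSpace σ)
    (adjoint X ∘L Y + adjoint Y ∘L X : AuxSpace σ →L[ℂ] AuxSpace σ)).re

/-- `S(σ)`: the operators `ψ : K → H` with `ψ†ψ = P(σ)`. -/
def purifications (σ : DensitySpectrum) (H : Type*) [NormedAddCommGroup H]
    [InnerProductSpace ℂ H] [CompleteSpace H] : Set (AuxSpace σ →L[ℂ] H) :=
  {ψ | adjoint ψ ∘L ψ = charOp σ}

/-- The bundle projection `π(ψ) = ψψ†`. -/
def bundleProj (ψ : AuxSpace σ →L[ℂ] H) : H →L[ℂ] H := ψ ∘L adjoint ψ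

/-- The tangent space of `S(σ)` at `ψ`: the kernel of the differential at `ψ` of the submersion
`ψ ↦ ψ†ψ` (into the Hermitian operators on `K`). -/
def tangentAt (ψ : AuxSpace σ →L[ℂ] H) : Set (AuxSpace σ →L[ℂ] H) :=
  {X | adjoint X ∘L ψ + adjoint ψ ∘L X = 0}

/-- The differential of the bundle projection, `dπ_ψ(X) = Xψ† + ψX†`. -/
def projDiff (ψ X : AuxSpace σ →L[ℂ] H) : H →L[ℂ] H :=
  X ∘L adjoint ψ + ψ ∘L adjoint X

/-- Vertical vectors at `ψ`: tangent vectors in the kernel of `dπ`. -/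
def verticalAt (ψ : AuxSpace σ →L[ℂ] H) : Set (AuxSpace σ →L[ℂ] H) :=
  {X | X ∈ tangentAt ψ ∧ projDiff ψ X = 0}

/-- Horizontal vectors at `ψ`: tangent vectors that are `G`-orthogonal to the vertical ones. -/
def horizontalAt (ψ : AuxSpace σ →L[ℂ] H) : Set (AuxSpace σ →L[ℂ] H) :=
  {X | X ∈ tangentAt ψ ∧ ∀ V ∈ verticalAt ψ, hsMetric X V = 0}

/-- `X` and `Y` are the horizontal lifts to the point `ψ` of the fibre over `ρ` of the tangent
vectors `A` and `B` of `D(σ)` at `ρ`. -/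
structure AreHorizontalLifts (ρ A B : H →L[ℂ] H) (ψ X Y : AuxSpace σ →L[ℂ] H) : Prop where
  mem : ψ ∈ purifications σ H
  proj : bundleProj ψ = ρ
  horizontal_left : X ∈ horizontalAt ψ
  horizontal_right : Y ∈ horizontalAt ψ
  diff_left : projDiff ψ X = A
  diff_right : projDiff ψ Y = B

open Classical in
/-- The metric `g` on `D(σ)` that makes `π` a Riemannian submersion: `g_ρ(A, B) = G(X, Y)` for the
horizontal lifts `X`, `Y` of `A`, `B` at a point of the fibre over `ρ` (it does not matter which
point, by `orbitMetric_eq` below). The value is `0` where there are no lifts, that is, where `ρ`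
is not in `D(σ)` or `A`, `B` are not tangent to `D(σ)` at `ρ`. -/
def orbitMetric (σ : DensitySpectrum) (ρ A B : H →L[ℂ] H) : ℝ :=
  if h : ∃ q : (AuxSpace σ →L[ℂ] H) × (AuxSpace σ →L[ℂ] H) × (AuxSpace σ →L[ℂ] H),
      AreHorizontalLifts ρ A B q.1 q.2.1 q.2.2
  then hsMetric h.choose.2.1 h.choose.2.2 else 0

/-! ### `dπ` is an isometry on every horizontal space -/

/-- The inverse of `P(σ)`. -/
def charOpInv (σ : DensitySpectrum) : AuxSpace σ →L[ℂ] AuxSpace σ :=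
  ∑ j, ((σ.p j : ℂ)⁻¹) • blockProj σ j

theorem inner_ket (i i' : Σ j : Fin σ.l, Fin (σ.m j)) :
    inner ℂ (ket σ i) (ket σ i') = if i = i' then (1 : ℂ) else 0 := by
  simp only [ket, EuclideanSpace.inner_single_left, map_one, one_mul]
  simp

theorem blockProj_ket (j : Fin σ.l) (i : Σ j : Fin σ.l, Fin (σ.m j)) :
    blockProj σ j (ket σ i) = if i.1 = j then ket σ i else 0 := by
  obtain ⟨j', i⟩ := i
  simp only [blockProj, sum_apply, InnerProductSpace.rankOne_apply, inner_ket]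
  by_cases h : j' = j
  · subst h
    rw [Finset.sum_eq_single i]
    · simp
    · intro b _ hb
      simp [hb]
    · simp
  · rw [if_neg h]
    refine Finset.sum_eq_zero fun b _ => ?_
    have : (⟨j, b⟩ : Σ j : Fin σ.l, Fin (σ.m j)) ≠ ⟨j', i⟩ := by
      intro h'; exact h (congrArg Sigma.fst h').symm
    rw [if_neg this, zero_smul]

theorem charOp_ket (i : Σ j : Fin σ.l, Fin (σ.m j)) :
    charOp σ (ket σ i) = (σ.p i.1 : ℂ) • ket σ i := by
  simp [charOp, blockProj_ket]

theorem charOpInv_ket (i : Σ j : Fin σ.l, Fin (σ.m j)) :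
    charOpInv σ (ket σ i) = ((σ.p i.1 : ℂ)⁻¹) • ket σ i := by
  simp [charOpInv, blockProj_ket]

theorem ext_ket {A B : AuxSpace σ →L[ℂ] AuxSpace σ} (h : ∀ i, A (ket σ i) = B (ket σ i)) :
    A = B := by
  have : (A : AuxSpace σ →ₗ[ℂ] AuxSpace σ) = B := by
    refine (EuclideanSpace.basisFun _ ℂ).toBasis.ext fun i => ?_
    simpa [ket] using h i
  exact ContinuousLinearMap.coe_injective this

theorem charOp_comp_inv : charOp σ ∘L charOpInv σ = .id ℂ _ := by
  refine ext_ket fun i => ?_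
  have : (σ.p i.1 : ℂ) ≠ 0 := by exact_mod_cast (σ.p_pos i.1).ne'
  rw [comp_apply, charOpInv_ket, map_smul, charOp_ket, smul_smul, inv_mul_cancel₀ this, one_smul]
  rfl

theorem charOpInv_comp : charOpInv σ ∘L charOp σ = .id ℂ _ := by
  refine ext_ket fun i => ?_
  have : (σ.p i.1 : ℂ) ≠ 0 := by exact_mod_cast (σ.p_pos i.1).ne'
  rw [comp_apply, charOp_ket, map_smul, charOpInv_ket, smul_smul, mul_inv_cancel₀ this, one_smul]
  rfl

theorem charOp_cancel_left {A B : AuxSpace σ →L[ℂ] AuxSpace σ}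
    (h : charOp σ ∘L A = charOp σ ∘L B) : A = B := by
  have := congrArg (fun C => charOpInv σ ∘L C) h
  simpa only [← comp_assoc, charOpInv_comp, id_comp] using this

theorem charOp_cancel_right {E : Type*} [NormedAddCommGroup E] [InnerProductSpace ℂ E]
    {A B : AuxSpace σ →L[ℂ] E}
    (h : A ∘L charOp σ = B ∘L charOp σ) : A = B := by
  have := congrArg (fun C => C ∘L charOpInv σ) h
  simpa only [comp_assoc, charOp_comp_inv, comp_id] using this

/-- Two points of `S(σ)` in the same fibre differ by a unitary operator on `K`. -/
theorem exists_gauge {ψ φ : AuxSpace σ →L[ℂ] H} (hψ : ψ ∈ purifications σ H)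
    (hφ : φ ∈ purifications σ H) (h : bundleProj ψ = bundleProj φ) :
    ∃ W : AuxSpace σ →L[ℂ] AuxSpace σ, φ = ψ ∘L W ∧ adjoint W ∘L W = .id ℂ _ ∧
      W ∘L adjoint W = .id ℂ _ := by
  have eψ : adjoint ψ ∘L ψ = charOp σ := hψ
  have eφ : adjoint φ ∘L φ = charOp σ := hφ
  have hpr : ψ ∘L adjoint ψ = φ ∘L adjoint φ := h
  obtain ⟨W, hW⟩ : ∃ W, W = charOpInv σ ∘L adjoint ψ ∘L φ := ⟨_, rfl⟩
  have h1 : charOp σ ∘L W = adjoint ψ ∘L φ := by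
    rw [hW, ← comp_assoc, charOp_comp_inv, id_comp]
  have h2 : charOp σ ∘L W = W ∘L charOp σ := by
    apply charOp_cancel_left
    calc charOp σ ∘L charOp σ ∘L W = adjoint ψ ∘L (ψ ∘L adjoint ψ) ∘L φ := by
          rw [h1, ← eψ]; simp only [comp_assoc]
      _ = (adjoint ψ ∘L φ) ∘L (adjoint φ ∘L φ) := by rw [hpr]; simp only [comp_assoc]
      _ = charOp σ ∘L W ∘L charOp σ := by rw [← h1, eφ, comp_assoc]
  have h3 : φ = ψ ∘L W := by
    apply charOp_cancel_right
    calc φ ∘L charOp σ = (φ ∘L adjoint φ) ∘L φ := by rw [← eφ, comp_assoc]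
      _ = ψ ∘L (adjoint ψ ∘L φ) := by rw [← hpr, comp_assoc]
      _ = (ψ ∘L W) ∘L charOp σ := by rw [← h1, h2, comp_assoc]
  have h4 : adjoint W ∘L W = .id ℂ _ := by
    apply charOp_cancel_right
    calc (adjoint W ∘L W) ∘L charOp σ = adjoint W ∘L (adjoint ψ ∘L ψ) ∘L W := by
          rw [eψ, h2, comp_assoc]
      _ = adjoint φ ∘L φ := by rw [h3, adjoint_comp]; simp only [comp_assoc]
      _ = ContinuousLinearMap.id ℂ _ ∘L charOp σ := by rw [eφ, id_comp]
  refine ⟨W, h3, h4, ?_⟩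
  apply charOp_cancel_left
  apply charOp_cancel_right
  calc (charOp σ ∘L W ∘L adjoint W) ∘L charOp σ
      = adjoint ψ ∘L ((ψ ∘L W) ∘L adjoint (ψ ∘L W)) ∘L ψ := by
        rw [adjoint_comp, ← eψ]; simp only [comp_assoc]
    _ = adjoint ψ ∘L (ψ ∘L adjoint ψ) ∘L ψ := by rw [← h3, hpr]
    _ = (charOp σ ∘L ContinuousLinearMap.id ℂ _) ∘L charOp σ := by
        rw [comp_id, ← eψ]; simp only [comp_assoc]

theorem hsMetric_comp_left (X V : AuxSpace σ →L[ℂ] H) (W : AuxSpace σ →L[ℂ] AuxSpace σ) :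
    hsMetric (X ∘L W) V = hsMetric X (V ∘L adjoint W) := by
  have h1 := LinearMap.trace_mul_comm ℂ
    (adjoint W : AuxSpace σ →ₗ[ℂ] AuxSpace σ) (adjoint X ∘L V : AuxSpace σ →L[ℂ] AuxSpace σ)
  have h2 := LinearMap.trace_mul_comm ℂ
    (W : AuxSpace σ →ₗ[ℂ] AuxSpace σ) (adjoint V ∘L X : AuxSpace σ →L[ℂ] AuxSpace σ)
  have e1 : (adjoint (X ∘L W) ∘L V + adjoint V ∘L (X ∘L W) : AuxSpace σ →L[ℂ] AuxSpace σ)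
      = adjoint W * (adjoint X ∘L V) + (adjoint V ∘L X) * W := by
    rw [adjoint_comp]; rfl
  have e2 : (adjoint X ∘L (V ∘L adjoint W) + adjoint (V ∘L adjoint W) ∘L X :
      AuxSpace σ →L[ℂ] AuxSpace σ) = (adjoint X ∘L V) * adjoint W + W * (adjoint V ∘L X) := by
    rw [adjoint_comp, adjoint_adjoint]; rfl
  unfold hsMetric
  rw [e1, e2]
  simp only [toLinearMap_add, toLinearMap_mul, map_add]
  rw [h1, h2]

theorem hsMetric_self_eq_zero {X : AuxSpace σ →L[ℂ] H} (h : hsMetric X X = 0) : X = 0 := by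
  unfold hsMetric at h
  rw [LinearMap.trace_eq_sum_inner _ (EuclideanSpace.basisFun _ ℂ)] at h
  have h' : ∑ i : (Σ j : Fin σ.l, Fin (σ.m j)), ‖X (ket σ i)‖ ^ 2 = 0 := by
    rw [← h, Complex.re_sum, Finset.mul_sum]
    refine Finset.sum_congr rfl fun i _ => ?_
    simp [ket, inner_add_right, adjoint_inner_right, inner_self_eq_norm_sq_to_K]
    norm_cast
    ring
  rw [Finset.sum_eq_zero_iff_of_nonneg (fun _ _ => by positivity)] at h'
  have : (X : AuxSpace σ →ₗ[ℂ] H) = 0 := by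
    refine (EuclideanSpace.basisFun _ ℂ).toBasis.ext fun i => ?_
    simpa [ket] using h' i (Finset.mem_univ i)
  exact ContinuousLinearMap.coe_injective this

theorem tangentAt_comp {ψ X : AuxSpace σ →L[ℂ] H} (hX : X ∈ tangentAt ψ)
    (W : AuxSpace σ →L[ℂ] AuxSpace σ) : X ∘L W ∈ tangentAt (ψ ∘L W) := by
  have hX' : adjoint X ∘L ψ + adjoint ψ ∘L X = 0 := hX
  calc adjoint (X ∘L W) ∘L (ψ ∘L W) + adjoint (ψ ∘L W) ∘L (X ∘L W)
      = adjoint W ∘L (adjoint X ∘L ψ + adjoint ψ ∘L X) ∘L W := by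
        rw [adjoint_comp, adjoint_comp, add_comp, comp_add]; simp only [comp_assoc]
    _ = 0 := by rw [hX', zero_comp, comp_zero]

theorem projDiff_comp (ψ X : AuxSpace σ →L[ℂ] H) {W : AuxSpace σ →L[ℂ] AuxSpace σ}
    (hW : W ∘L adjoint W = .id ℂ _) : projDiff (ψ ∘L W) (X ∘L W) = projDiff ψ X := by
  have key (A B : AuxSpace σ →L[ℂ] H) : (A ∘L W) ∘L adjoint (B ∘L W) = A ∘L adjoint B := by
    calc (A ∘L W) ∘L adjoint (B ∘L W) = A ∘L (W ∘L adjoint W) ∘L adjoint B := by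
          rw [adjoint_comp]; simp only [comp_assoc]
      _ = A ∘L adjoint B := by rw [hW, id_comp]
  unfold projDiff
  rw [key, key]

theorem horizontalAt_comp {ψ X : AuxSpace σ →L[ℂ] H} (hX : X ∈ horizontalAt ψ)
    {W : AuxSpace σ →L[ℂ] AuxSpace σ} (hW : adjoint W ∘L W = .id ℂ _)
    (hW' : W ∘L adjoint W = .id ℂ _) : X ∘L W ∈ horizontalAt (ψ ∘L W) := by
  refine ⟨tangentAt_comp hX.1 W, fun V hV => ?_⟩
  rw [hsMetric_comp_left]
  have e : (ψ ∘L W) ∘L adjoint W = ψ := by rw [comp_assoc, hW', comp_id]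
  refine hX.2 _ ⟨?_, ?_⟩
  · simpa only [e] using tangentAt_comp hV.1 (adjoint W)
  · have := projDiff_comp (ψ ∘L W) V (W := adjoint W) (by rw [adjoint_adjoint, hW])
    rw [e] at this
    rw [this, hV.2]

theorem horizontal_unique {ψ X Y : AuxSpace σ →L[ℂ] H} (hX : X ∈ horizontalAt ψ)
    (hY : Y ∈ horizontalAt ψ) (h : projDiff ψ X = projDiff ψ Y) : X = Y := by
  have hT : X - Y ∈ tangentAt ψ := by
    have h1 : adjoint X ∘L ψ + adjoint ψ ∘L X = 0 := hX.1
    have h2 : adjoint Y ∘L ψ + adjoint ψ ∘L Y = 0 := hY.1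
    change adjoint (X - Y) ∘L ψ + adjoint ψ ∘L (X - Y) = 0
    rw [map_sub, sub_comp, comp_sub]
    calc _ = (adjoint X ∘L ψ + adjoint ψ ∘L X) - (adjoint Y ∘L ψ + adjoint ψ ∘L Y) := by abel
      _ = 0 := by rw [h1, h2, sub_zero]
  have hV : X - Y ∈ verticalAt ψ := by
    refine ⟨hT, ?_⟩
    have h' : X ∘L adjoint ψ + ψ ∘L adjoint X = Y ∘L adjoint ψ + ψ ∘L adjoint Y := h
    unfold projDiff
    rw [map_sub, sub_comp, comp_sub]
    calc _ = (X ∘L adjoint ψ + ψ ∘L adjoint X) - (Y ∘L adjoint ψ + ψ ∘L adjoint Y) := by abel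
      _ = 0 := by rw [h', sub_self]
  have h0 : hsMetric (X - Y) (X - Y) = 0 := by
    have h1 := hX.2 _ hV
    have h2 := hY.2 _ hV
    have : hsMetric (X - Y) (X - Y) = hsMetric X (X - Y) - hsMetric Y (X - Y) := by
      unfold hsMetric
      rw [← mul_sub, ← Complex.sub_re, ← map_sub, ← toLinearMap_sub]
      congr 4
      simp only [map_sub, sub_comp, comp_sub]
      abel
    rw [this, h1, h2, sub_zero]
  exact sub_eq_zero.mp (hsMetric_self_eq_zero h0)

/-- The differential of `π` maps every horizontal space isometrically: the value of `g` does not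
depend on the choices made in its definition. -/
theorem orbitMetric_eq {ψ X Y : AuxSpace σ →L[ℂ] H} (hψ : ψ ∈ purifications σ H)
    (hX : X ∈ horizontalAt ψ) (hY : Y ∈ horizontalAt ψ) :
    orbitMetric σ (bundleProj ψ) (projDiff ψ X) (projDiff ψ Y) = hsMetric X Y := by
  have h : ∃ q : (AuxSpace σ →L[ℂ] H) × (AuxSpace σ →L[ℂ] H) × (AuxSpace σ →L[ℂ] H),
      AreHorizontalLifts (bundleProj ψ) (projDiff ψ X) (projDiff ψ Y) q.1 q.2.1 q.2.2 :=
    ⟨(ψ, X, Y), hψ, rfl, hX, hY, rfl, rfl⟩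
  unfold orbitMetric
  rw [dif_pos h]
  have hq := h.choose_spec
  generalize h.choose = q at hq ⊢
  obtain ⟨φ, X', Y'⟩ := q
  obtain ⟨W, rfl, hW, hW'⟩ := exists_gauge hψ hq.mem hq.proj.symm
  have eX : X' = X ∘L W := horizontal_unique hq.horizontal_left
    (horizontalAt_comp hX hW hW') (by rw [hq.diff_left, projDiff_comp ψ X hW'])
  have eY : Y' = Y ∘L W := horizontal_unique hq.horizontal_right
    (horizontalAt_comp hY hW hW') (by rw [hq.diff_right, projDiff_comp ψ Y hW'])
  simp only
  rw [eX, eY, hsMetric_comp_left, comp_assoc, hW', comp_id]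

end Bundle

/-! ## Curves of isospectral states, length and geodesic distance -/

section Curves

variable {H : Type*} [NormedAddCommGroup H] [InnerProductSpace ℂ H] [CompleteSpace H]

/-- `ρ(t)`, `0 ≤ t ≤ τ`, is a continuously differentiable curve in `D(σ)` from `ρ₀` to `ρ₁`. -/
structure IsCurveIn (σ : DensitySpectrum) (ρ₀ ρ₁ : H →L[ℂ] H) (τ : ℝ) (ρ : ℝ → H →L[ℂ] H) :
    Prop where
  contDiffOn : ContDiffOn ℝ 1 ρ (Set.Icc 0 τ)
  mem : ∀ t ∈ Set.Icc 0 τ, ρ t ∈ isospectral σ H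
  initial : ρ 0 = ρ₀
  final : ρ τ = ρ₁

/-- The length `∫₀^τ √(g(ρ', ρ')) dt` of a curve in `D(σ)`. -/
def curveLength (σ : DensitySpectrum) (τ : ℝ) (ρ : ℝ → H →L[ℂ] H) : ℝ :=
  ∫ t in (0 : ℝ)..τ, √(orbitMetric σ (ρ t)
    (derivWithin ρ (Set.Icc 0 τ) t) (derivWithin ρ (Set.Icc 0 τ) t))

/-- The geodesic distance in `D(σ)`: the infimum of the lengths of the curves in `D(σ)` that
connect the two points. -/
def geodesicDist (σ : DensitySpectrum) (ρ₀ ρ₁ : H →L[ℂ] H) : ℝ :=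
  sInf {L : ℝ | ∃ τ : ℝ, 0 < τ ∧ ∃ ρ : ℝ → H →L[ℂ] H,
    IsCurveIn σ ρ₀ ρ₁ τ ρ ∧ L = curveLength σ τ ρ}

/-! ## Von Neumann evolution and energy uncertainty -/

/-- A (possibly time-dependent) Hamiltonian on the time interval `[0, τ]`: a continuous curve of
self-adjoint operators on `H`. -/
structure IsHamiltonian (τ : ℝ) (A : ℝ → H →L[ℂ] H) : Prop where
  continuousOn : ContinuousOn A (Set.Icc 0 τ)
  isSelfAdjoint : ∀ t ∈ Set.Icc 0 τ, IsSelfAdjoint (A t)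

/-- The von Neumann vector field `X_H(ρ) = [H, ρ] / (iħ)`. -/
def vonNeumannField (ℏ : ℝ) (A ρ : H →L[ℂ] H) : H →L[ℂ] H :=
  (1 / (Complex.I * ℏ)) • (A ∘L ρ - ρ ∘L A)

/-- `ρ(t)`, `0 ≤ t ≤ τ`, solves the boundary value von Neumann equation
`ρ' = X_H(ρ)`, `ρ(0) = ρ₀`, `ρ(τ) = ρ₁`. -/
structure IsVonNeumannSolution (ℏ τ : ℝ) (A : ℝ → H →L[ℂ] H) (ρ₀ ρ₁ : H →L[ℂ] H)
    (ρ : ℝ → H →L[ℂ] H) : Prop where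
  hasDeriv : ∀ t ∈ Set.Icc 0 τ,
    HasDerivWithinAt ρ (vonNeumannField ℏ (A t) (ρ t)) (Set.Icc 0 τ) t
  initial : ρ 0 = ρ₀
  final : ρ τ = ρ₁

/-- The uncertainty `ΔH(ρ) = √(Tr(H²ρ) - Tr(Hρ)²)`. -/
def uncertainty (A ρ : H →L[ℂ] H) : ℝ :=
  √((opTrace (A ∘L A ∘L ρ)).re - (opTrace (A ∘L ρ)).re ^ 2)

/-- The energy dispersion integral `(1/ħ) ∫₀^τ ΔH(ρ) dt`. -/
def energyDispersion (ℏ τ : ℝ) (A ρ : ℝ → H →L[ℂ] H) : ℝ :=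
  (1 / ℏ) * ∫ t in (0 : ℝ)..τ, uncertainty (A t) (ρ t)

/-- The time averaged energy uncertainty `ΔE = (1/τ) ∫₀^τ ΔH(ρ) dt`. -/
def averageUncertainty (τ : ℝ) (A ρ : ℝ → H →L[ℂ] H) : ℝ :=
  (1 / τ) * ∫ t in (0 : ℝ)..τ, uncertainty (A t) (ρ t)

/-- The fidelity `F(ρ₀, ρ₁) = (Tr √(√ρ₀ ρ₁ √ρ₀))²`. -/
def fidelity (ρ₀ ρ₁ : H →L[ℂ] H) : ℝ :=
  (opTrace (CFC.sqrt (CFC.sqrt ρ₀ ∘L ρ₁ ∘L CFC.sqrt ρ₀))).re ^ 2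

/-- The Bures length `arccos √F(ρ₀, ρ₁)`. -/
def buresLength (ρ₀ ρ₁ : H →L[ℂ] H) : ℝ := Real.arccos √(fidelity ρ₀ ρ₁)

end Curves

end

end QuantumSpeed

namespace QuantumSpeed

open ContinuousLinearMap

noncomputable section

/-! ## Traces over the purifying space -/

section Purification

variable {H : Type*} [NormedAddCommGroup H] [InnerProductSpace ℂ H] [CompleteSpace H]
  {σ : DensitySpectrum}

/-! At a state `ρ = ψψ†`, split a Hamiltonian `A` along the eigenspaces of `ρ`. The diagonal blocks
commute with `ρ`, so the off-diagonal part `B` generates the same velocity `[A, ρ]/(iħ)`. Vertical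
vectors at `ψ` send each basis vector of `K` into the same eigenspace as `ψ` does. Hence `Bψ/(iħ)`
is orthogonal to all of them and is the horizontal lift of the velocity, and the speed is `ħ⁻¹ √(∑
‖Bψeᵢ‖²)`. This equals `ΔB/ħ`, because `B` has expectation `0` (`sqrt_orbitMetric_eq`), and it is at
most `ΔA/ħ` by Pythagoras (`sqrt_orbitMetric_le`). Integration gives length ≤ energy dispersion for
every evolution.

Conversely, the velocity of a `C¹` curve in `D(σ)` has no diagonal blocks, so dividing its blocks by
differences of eigenvalues produces a continuous off-diagonal Hamiltonian that drives the curve with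
dispersion equal to length (`exists_hamiltonian_of_isCurveIn`). An affine change of time then
reaches any prescribed `τ`. The orbit is path connected, since two of its states are conjugate by a
unitary on a finite dimensional subspace, which has a logarithm (`exists_isCurveIn`). So the infima
are over nonempty sets and agree.

A solution of the von Neumann equation is tied to the bundle by a Schrödinger lift, obtained from a
Dyson series and uniqueness for linear equations (`exists_schrodinger_lift`). In particular it stays
in `D(σ)`.

For the Bures bound, lift a curve horizontally without changing its length. `S(σ)` lies in the unit
sphere of `G`, so the length is at least `arccos G(ψ(0), ψ(τ))`, and an overlap of purifications
never exceeds `√F` (`hsMetric_le_sqrt_fidelity`, one half of Uhlmann's theorem). -/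

theorem ext_on_ket {E : Type*} [NormedAddCommGroup E] [InnerProductSpace ℂ E]
    {A B : AuxSpace σ →L[ℂ] E} (h : ∀ i, A (ket σ i) = B (ket σ i)) : A = B := by
  have : (A : AuxSpace σ →ₗ[ℂ] E) = B := by
    refine (EuclideanSpace.basisFun _ ℂ).toBasis.ext fun i => ?_
    simpa [ket] using h i
  exact ContinuousLinearMap.coe_injective this

theorem sum_smul_ket (x : AuxSpace σ) : ∑ i, x i • ket σ i = x := by
  have := (EuclideanSpace.basisFun (Σ j : Fin σ.l, Fin (σ.m j)) ℂ).sum_repr x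
  simpa [ket] using this

theorem adjoint_apply_coord (Y : AuxSpace σ →L[ℂ] H) (v : H) (i : Σ j : Fin σ.l, Fin (σ.m j)) :
    (adjoint Y v) i = inner ℂ (Y (ket σ i)) v := by
  rw [← adjoint_inner_right, ket, EuclideanSpace.inner_single_left, map_one, one_mul]

theorem comp_adjoint_apply (X Y : AuxSpace σ →L[ℂ] H) (v : H) :
    X (adjoint Y v) = ∑ i, inner ℂ (Y (ket σ i)) v • X (ket σ i) := by
  conv_lhs => rw [← sum_smul_ket (adjoint Y v)]
  simp [adjoint_apply_coord]

theorem hsMetric_eq_sum (X Y : AuxSpace σ →L[ℂ] H) :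
    hsMetric X Y = ∑ i, (inner ℂ (X (ket σ i)) (Y (ket σ i))).re := by
  unfold hsMetric
  rw [LinearMap.trace_eq_sum_inner _ (EuclideanSpace.basisFun _ ℂ), Complex.re_sum, Finset.mul_sum]
  refine Finset.sum_congr rfl fun i _ => ?_
  have h : (inner ℂ (Y (ket σ i)) (X (ket σ i))).re = (inner ℂ (X (ket σ i)) (Y (ket σ i))).re :=
    inner_re_symm (𝕜 := ℂ) _ _
  simp only [EuclideanSpace.basisFun_apply, coe_coe, add_apply, comp_apply, inner_add_right,
    adjoint_inner_right, Complex.add_re]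
  change 1 / 2 * ((inner ℂ (X (ket σ i)) (Y (ket σ i))).re
    + (inner ℂ (Y (ket σ i)) (X (ket σ i))).re) = _
  rw [h]
  ring

theorem hsMetric_self_eq_sum (X : AuxSpace σ →L[ℂ] H) :
    hsMetric X X = ∑ i, ‖X (ket σ i)‖ ^ 2 := by
  rw [hsMetric_eq_sum]
  refine Finset.sum_congr rfl fun i _ => ?_
  exact inner_self_eq_norm_sq (𝕜 := ℂ) _

/-- Parseval's identity in the chosen Hilbert basis, one rank one term at a time. All traces on `H`
below become finite sums through this lemma. -/
theorem hasSum_diagCoeff_of_eq_sum {ι : Type*} [Fintype ι] {T : H →L[ℂ] H} {x y : ι → H}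
    (hT : ∀ v, T v = ∑ i, inner ℂ (y i) v • x i) :
    HasSum (diagCoeff T) (∑ i, inner ℂ (y i) (x i)) := by
  obtain ⟨b, hb⟩ := (exists_hilbertBasis ℂ H).choose_spec
  have h := hasSum_sum (s := Finset.univ) fun i _ => b.hasSum_inner_mul_inner (y i) (x i)
  convert! h using 2 with e
  simp [diagCoeff, hT, hb, inner_sum, inner_smul_right]

theorem hasSum_diagCoeff_comp_adjoint (X Y : AuxSpace σ →L[ℂ] H) :
    HasSum (diagCoeff (X ∘L adjoint Y)) (∑ i, inner ℂ (Y (ket σ i)) (X (ket σ i))) :=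
  hasSum_diagCoeff_of_eq_sum fun v => by rw [comp_apply, comp_adjoint_apply]

theorem opTrace_comp_adjoint (X Y : AuxSpace σ →L[ℂ] H) :
    opTrace (X ∘L adjoint Y) = ∑ i, inner ℂ (Y (ket σ i)) (X (ket σ i)) :=
  (hasSum_diagCoeff_comp_adjoint X Y).tsum_eq

theorem inner_purification {ψ : AuxSpace σ →L[ℂ] H} (hψ : ψ ∈ purifications σ H)
    (i j : Σ j : Fin σ.l, Fin (σ.m j)) :
    inner ℂ (ψ (ket σ i)) (ψ (ket σ j)) = if i = j then (σ.p i.1 : ℂ) else 0 := by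
  have e : adjoint ψ ∘L ψ = charOp σ := hψ
  rw [← adjoint_inner_right, ← comp_apply, e, charOp_ket, inner_smul_right, inner_ket]
  split_ifs with h
  · rw [h, mul_one]
  · rw [mul_zero]

theorem mem_purifications_of_inner {ψ : AuxSpace σ →L[ℂ] H}
    (h : ∀ i j, inner ℂ (ψ (ket σ i)) (ψ (ket σ j)) = if i = j then (σ.p i.1 : ℂ) else 0) :
    ψ ∈ purifications σ H := by
  refine ext_ket fun j => ?_
  ext i
  rw [comp_apply, adjoint_apply_coord, h, charOp_ket]
  have := inner_ket (σ := σ) i j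
  simp only [ket, EuclideanSpace.inner_single_left, map_one, one_mul] at this
  rw [PiLp.smul_apply, ket, this, smul_eq_mul]
  split_ifs with h
  · rw [h, mul_one]
  · rw [mul_zero]

theorem sum_block (f : Fin σ.l → ℝ) :
    ∑ i : (Σ j : Fin σ.l, Fin (σ.m j)), f i.1 = ∑ j, (σ.m j : ℝ) * f j := by
  rw [Fintype.sum_sigma]
  simp

theorem hsMetric_purification {ψ : AuxSpace σ →L[ℂ] H} (hψ : ψ ∈ purifications σ H) :
    hsMetric ψ ψ = 1 := by
  rw [hsMetric_eq_sum]
  simp only [inner_purification hψ, if_true, Complex.ofReal_re]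
  rw [sum_block, σ.sum_eq_one]

theorem bundleProj_isPositive (ψ : AuxSpace σ →L[ℂ] H) : (bundleProj ψ).IsPositive := by
  exact IsPositive.conj_adjoint (T := (1 : AuxSpace σ →L[ℂ] AuxSpace σ)) isPositive_one ψ

theorem bundleProj_mem_isospectral {ψ : AuxSpace σ →L[ℂ] H} (hψ : ψ ∈ purifications σ H) :
    bundleProj ψ ∈ isospectral σ H := by
  have e : adjoint ψ ∘L ψ = charOp σ := hψ
  -- Since `ψ†(ψψ†) = P(σ)ψ†`, the vector `ψ†v` is an eigenvector of the diagonal operator `P(σ)` or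
  -- zero, so it lives on the block whose entry is `x`.
  have key (x : ℝ) (v : H) (hv : bundleProj ψ v = (x : ℂ) • v)
      (i : Σ j : Fin σ.l, Fin (σ.m j)) : ((σ.p i.1 : ℂ) - x) * (adjoint ψ v) i = 0 := by
    have h1 : adjoint ψ (bundleProj ψ v) = (x : ℂ) • adjoint ψ v := by rw [hv, map_smul]
    have h2 : (adjoint ψ (bundleProj ψ v)) i = (σ.p i.1 : ℂ) * (adjoint ψ v) i := by
      rw [adjoint_apply_coord, bundleProj, comp_apply, comp_adjoint_apply, inner_sum]
      simp only [inner_smul_right, inner_purification hψ]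
      simp [adjoint_apply_coord, mul_comm]
    rw [h1, PiLp.smul_apply, smul_eq_mul] at h2
    rw [sub_mul, h2, sub_self]
  refine ⟨⟨bundleProj_isPositive ψ, ?_⟩, ?_, ?_, ?_⟩
  · convert! hasSum_diagCoeff_comp_adjoint ψ ψ using 1
    simp only [inner_purification hψ, if_true]
    rw [← Complex.ofReal_sum, sum_block, σ.sum_eq_one, Complex.ofReal_one]
  · refine Submodule.finiteDimensional_of_le (S₂ := LinearMap.range (ψ : AuxSpace σ →ₗ[ℂ] H)) ?_
    rintro _ ⟨v, rfl⟩
    exact ⟨adjoint ψ v, rfl⟩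
  · intro x hx hev
    obtain ⟨v, hv, hv0⟩ := hev.exists_hasEigenvector
    rw [Module.End.mem_eigenspace_iff] at hv
    by_contra! hne
    apply hv0
    have h0 : adjoint ψ v = 0 := by
      ext i
      have := key x v hv i
      rcases mul_eq_zero.mp this with h | h
      · rw [sub_eq_zero] at h
        exact absurd (by exact_mod_cast h.symm) (hne i.1)
      · exact h
    have hv' : ψ (adjoint ψ v) = (x : ℂ) • v := hv
    rw [h0, map_zero] at hv'
    exact (smul_eq_zero.mp hv'.symm).resolve_left (by exact_mod_cast hx.ne')
  · intro j
    have hp : (σ.p j : ℂ) ≠ 0 := by exact_mod_cast (σ.p_pos j).ne'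
    have hli : LinearIndependent ℂ fun i : Fin (σ.m j) => ψ (ket σ ⟨j, i⟩) := by
      refine linearIndependent_of_ne_zero_of_inner_eq_zero (fun i h0 => ?_) fun i i' hne => ?_
      · have := inner_purification hψ ⟨j, i⟩ ⟨j, i⟩
        rw [h0, inner_zero_left, if_pos rfl] at this
        exact hp this.symm
      · simp only [inner_purification hψ]
        rw [if_neg (by simpa using hne)]
    have hsp : Module.End.eigenspace (bundleProj ψ : H →ₗ[ℂ] H) (σ.p j : ℂ)
        = Submodule.span ℂ (Set.range fun i : Fin (σ.m j) => ψ (ket σ ⟨j, i⟩)) := by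
      apply le_antisymm
      · intro v hv
        rw [Module.End.mem_eigenspace_iff] at hv
        have hv' : ψ (adjoint ψ v) = (σ.p j : ℂ) • v := hv
        have : v = (σ.p j : ℂ)⁻¹ • ψ (adjoint ψ v) := by
          rw [hv', smul_smul, inv_mul_cancel₀ hp, one_smul]
        rw [this, ← sum_smul_ket (adjoint ψ v), map_sum]
        refine Submodule.smul_mem _ _ (Submodule.sum_mem _ fun i _ => ?_)
        rw [map_smul]
        rcases mul_eq_zero.mp (key _ v hv i) with h | h
        · obtain ⟨j', i⟩ := i
          have : j' = j := σ.p_strictAnti.injective (by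
            rw [sub_eq_zero] at h; exact_mod_cast h)
          subst this
          exact Submodule.smul_mem _ _ (Submodule.subset_span ⟨i, rfl⟩)
        · rw [h, zero_smul]; exact zero_mem _
      · rw [Submodule.span_le]
        rintro _ ⟨i, rfl⟩
        rw [SetLike.mem_coe, Module.End.mem_eigenspace_iff]
        change ψ ((adjoint ψ ∘L ψ) (ket σ ⟨j, i⟩)) = _
        rw [e, charOp_ket, map_smul]
    rw [hsp, finrank_span_eq_card hli, Fintype.card_fin]

/-- Send the `j`-th block to `√p_j` times an orthonormal basis of the eigenspace of `p_j`. The work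
is in `ψψ† = ρ`: the difference of the two sides annihilates the listed eigenspaces, and these
exhaust the range of `ρ`. -/
theorem exists_purification {ρ : H →L[ℂ] H} (hρ : ρ ∈ isospectral σ H) :
    ∃ ψ ∈ purifications σ H, bundleProj ψ = ρ := by
  obtain ⟨⟨hpos, -⟩, hfd, hev, hmul⟩ := hρ
  have hsymm : (ρ : H →ₗ[ℂ] H).IsSymmetric := hpos.isSelfAdjoint.isSymmetric
  let V (j : Fin σ.l) := Module.End.eigenspace (ρ : H →ₗ[ℂ] H) (σ.p j : ℂ)
  have hVfd (j) : FiniteDimensional ℂ (V j) :=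
    Module.finite_of_finrank_pos (by rw [hmul]; exact σ.m_pos j)
  let b (j : Fin σ.l) : OrthonormalBasis (Fin (σ.m j)) ℂ (V j) :=
    (stdOrthonormalBasis ℂ (V j)).reindex (finCongr (hmul j))
  have hb (j i) : ρ (b j i) = (σ.p j : ℂ) • (b j i : H) :=
    Module.End.mem_eigenspace_iff.mp (b j i).2
  have hbb (i i' : Σ j : Fin σ.l, Fin (σ.m j)) :
      inner ℂ (b i.1 i.2 : H) (b i'.1 i'.2 : H) = if i = i' then (1 : ℂ) else 0 := by
    obtain ⟨j, i⟩ := i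
    obtain ⟨j', i'⟩ := i'
    by_cases h : j = j'
    · subst h
      rw [← Submodule.coe_inner, orthonormal_iff_ite.mp (b j).orthonormal]
      simp
    · rw [if_neg (by simp [h])]
      have hne : (σ.p j : ℂ) ≠ σ.p j' := fun h' => h (σ.p_strictAnti.injective (by
        exact_mod_cast h'))
      exact hsymm.orthogonalFamily_eigenspaces hne (b j i) (b j' i')
  let φ : AuxSpace σ →ₗ[ℂ] H := (EuclideanSpace.basisFun _ ℂ).toBasis.constr ℂ
    fun i => ((√(σ.p i.1) : ℝ) : ℂ) • (b i.1 i.2 : H)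
  let ψ : AuxSpace σ →L[ℂ] H := φ.toContinuousLinearMap
  have hψk (i) : ψ (ket σ i) = ((√(σ.p i.1) : ℝ) : ℂ) • (b i.1 i.2 : H) := by
    exact (by simp [ket] : ket σ i =
        (EuclideanSpace.basisFun (Σ j : Fin σ.l, Fin (σ.m j)) ℂ).toBasis i) ▸
      (EuclideanSpace.basisFun (Σ j : Fin σ.l, Fin (σ.m j)) ℂ).toBasis.constr_basis ℂ
      (fun i => ((√(σ.p i.1) : ℝ) : ℂ) • (b i.1 i.2 : H)) i
  have hsq (j) : ((√(σ.p j) : ℝ) : ℂ) * ((√(σ.p j) : ℝ) : ℂ) = σ.p j := by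
    rw [← Complex.ofReal_mul, Real.mul_self_sqrt (σ.p_pos j).le]
  have hψ : ψ ∈ purifications σ H := by
    refine mem_purifications_of_inner fun i j => ?_
    rw [hψk, hψk, inner_smul_left, inner_smul_right, hbb]
    split_ifs with h
    · subst h
      rw [Complex.conj_ofReal, mul_one, hsq]
    · simp
  refine ⟨ψ, hψ, ?_⟩
  have hρψ : ρ ∘L ψ = ψ ∘L charOp σ := by
    refine ext_on_ket fun i => ?_
    simp only [comp_apply, charOp_ket, hψk, map_smul, hb]
    rw [smul_comm]
  have hDψ : (ρ - bundleProj ψ) ∘L ψ = 0 := by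
    have e : adjoint ψ ∘L ψ = charOp σ := hψ
    rw [sub_comp, hρψ, bundleProj, comp_assoc, e, sub_self]
  have heig (j) (u : H) (hu : u ∈ V j) : (ρ - bundleProj ψ) u = 0 := by
    have h1 := (b j).sum_repr ⟨u, hu⟩
    have h2 : u = ∑ i, (b j).repr ⟨u, hu⟩ i • (b j i : H) := by
      conv_lhs => rw [show u = ((⟨u, hu⟩ : V j) : H) from rfl, ← h1]
      simp
    rw [h2, map_sum]
    refine Finset.sum_eq_zero fun i _ => ?_
    have hne : ((√(σ.p j) : ℝ) : ℂ) ≠ 0 := by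
      exact_mod_cast (Real.sqrt_pos.mpr (σ.p_pos j)).ne'
    have h3 : (b j i : H) = ((√(σ.p j) : ℝ) : ℂ)⁻¹ • ψ (ket σ ⟨j, i⟩) := by
      rw [hψk, smul_smul, inv_mul_cancel₀ hne, one_smul]
    rw [h3, map_smul, map_smul, ← comp_apply, hDψ]
    simp
  -- Diagonalize `ρ` on its finite dimensional range. The eigenvalues there are nonnegative by
  -- positivity and nonzero because the range is orthogonal to the kernel, so each is some `p_j`.
  have hDρ : (ρ - bundleProj ψ) ∘L ρ = 0 := by
    let R := LinearMap.range (ρ : H →ₗ[ℂ] H)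
    have hinv : ∀ v ∈ R, (ρ : H →ₗ[ℂ] H) v ∈ R := fun v _ => ⟨v, rfl⟩
    have hT := hsymm.restrict_invariant hinv
    let u := hT.eigenvectorBasis rfl
    have hu (n) : (ρ - bundleProj ψ) (u n : H) = 0 := by
      have h1 : ρ (u n : H) = (hT.eigenvalues rfl n : ℂ) • (u n : H) :=
        congrArg Subtype.val (hT.apply_eigenvectorBasis rfl n)
      have hun : (u n : H) ≠ 0 := by
        intro h
        have := (u.orthonormal.1 n)
        rw [Submodule.coe_norm, h, norm_zero] at this
        exact zero_ne_one this
      have hnn : 0 ≤ hT.eigenvalues rfl n := by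
        have h2 := hpos.inner_nonneg_right (u n : H)
        rw [h1, inner_smul_right, inner_self_eq_norm_sq_to_K, ← Submodule.coe_norm,
          u.orthonormal.1 n] at h2
        simpa using h2
      have hne : hT.eigenvalues rfl n ≠ 0 := by
        intro h0
        rw [h0, Complex.ofReal_zero, zero_smul] at h1
        obtain ⟨y, hy⟩ := (u n).2
        apply hun
        rw [← inner_self_eq_zero (𝕜 := ℂ)]
        nth_rewrite 1 [← hy]
        rw [hsymm y (u n : H), coe_coe, h1, inner_zero_right]
      obtain ⟨j, hj⟩ := hev _ (lt_of_le_of_ne hnn (Ne.symm hne))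
        (Module.End.hasEigenvalue_of_hasEigenvector
          ⟨Module.End.mem_eigenspace_iff.mpr h1, hun⟩)
      refine heig j _ (Module.End.mem_eigenspace_iff.mpr ?_)
      rw [← hj]
      exact h1
    ext y
    have h1 := u.sum_repr ⟨ρ y, ⟨y, rfl⟩⟩
    have h2 : ρ y = ∑ n, u.repr ⟨ρ y, ⟨y, rfl⟩⟩ n • (u n : H) := by
      conv_lhs => rw [show ρ y = ((⟨ρ y, ⟨y, rfl⟩⟩ : R) : H) from rfl, ← h1]
      simp
    rw [comp_apply, h2, map_sum]
    simp [hu]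
  have hsa : adjoint (ρ - bundleProj ψ) = ρ - bundleProj ψ :=
    (hpos.isSelfAdjoint.sub (bundleProj_isPositive ψ).isSelfAdjoint)
  -- The self-adjoint difference annihilates `ρ` and `ψ` from the left, so its square is zero.
  have hDD : adjoint (ρ - bundleProj ψ) ∘L (ρ - bundleProj ψ) = 0 := by
    rw [hsa, comp_sub, hDρ, bundleProj, ← comp_assoc]
    change 0 - ((ρ - bundleProj ψ) ∘L ψ) ∘L adjoint ψ = 0
    rw [hDψ, zero_comp, sub_zero]
  have : ρ - bundleProj ψ = 0 := by
    have h := CStarRing.norm_star_mul_self (x := ρ - bundleProj ψ)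
    rw [star_eq_adjoint, mul_def, hDD, norm_zero] at h
    exact norm_eq_zero.mp (mul_self_eq_zero.mp h.symm)
  exact (sub_eq_zero.mp this).symm

end Purification

/-! ## Spectral projections of isospectral states -/

section SpectralProjections

open scoped Polynomial
open Polynomial (aeval X C eval aeval_monomial eval_monomial eval_add eval_prod aeval_X)

variable {H : Type*} [NormedAddCommGroup H] [InnerProductSpace ℂ H] [CompleteSpace H]
  {σ : DensitySpectrum}

/-- The points of the spectrum of the states in `D(σ)`, including `0`. -/
def node (σ : DensitySpectrum) (i : Option (Fin σ.l)) : ℂ := i.elim 0 fun j => (σ.p j : ℂ)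

theorem node_injective : Function.Injective (node σ) := by
  have h (j : Fin σ.l) : (σ.p j : ℂ) ≠ 0 := by exact_mod_cast (σ.p_pos j).ne'
  rintro (_ | i) (_ | j) hij
  · rfl
  · exact absurd hij.symm (h j)
  · exact absurd hij (h i)
  · exact congrArg some (σ.p_strictAnti.injective (by
      simpa [node] using hij))

theorem conj_node (i : Option (Fin σ.l)) : star (node σ i) = node σ i := by
  cases i with
  | none => simp [node]
  | some j => simp [node]

/-- The spectral projection of a state in `D(σ)` that belongs to the point `node σ i`. -/
def spectralProj (σ : DensitySpectrum) (ρ : H →L[ℂ] H) (i : Option (Fin σ.l)) : H →L[ℂ] H :=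
  aeval ρ (Lagrange.basis Finset.univ (node σ) i)

theorem aeval_bundleProj_comp (ψ : AuxSpace σ →L[ℂ] H) (q : ℂ[X]) :
    aeval (bundleProj ψ) q ∘L ψ = ψ ∘L aeval (adjoint ψ ∘L ψ) q := by
  induction q using Polynomial.induction_on' with
  | add p q hp hq => rw [map_add, map_add, add_comp, comp_add, hp, hq]
  | monomial n a =>
    have h (n : ℕ) : (bundleProj ψ ^ n : H →L[ℂ] H) ∘L ψ = ψ ∘L ((adjoint ψ ∘L ψ) ^ n : AuxSpace σ →L[ℂ] AuxSpace σ) := by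
      induction n with
      | zero => rfl
      | succ n ih =>
        rw [pow_succ', pow_succ']
        change bundleProj ψ ∘L ((bundleProj ψ ^ n : H →L[ℂ] H) ∘L ψ) = _
        rw [ih]
        rfl
    rw [aeval_monomial, aeval_monomial, ← Algebra.smul_def, ← Algebra.smul_def, smul_comp,
      comp_smul, h]

theorem aeval_charOp_ket (q : ℂ[X]) (i : Σ j : Fin σ.l, Fin (σ.m j)) :
    aeval (charOp σ) q (ket σ i) = q.eval (σ.p i.1 : ℂ) • ket σ i := by
  induction q using Polynomial.induction_on' with
  | add p q hp hq => rw [map_add, eval_add, add_smul, add_apply, hp, hq]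
  | monomial n a =>
    have h (n : ℕ) : (charOp σ ^ n) (ket σ i) = (σ.p i.1 : ℂ) ^ n • ket σ i := by
      induction n with
      | zero => simp
      | succ n ih =>
        rw [pow_succ', mul_apply_eq_comp, ih, map_smul, charOp_ket, smul_smul, pow_succ]
    rw [aeval_monomial, ← Algebra.smul_def, smul_apply, h, eval_monomial, mul_smul]

/-- The factor of the node `0` is `ψψ†`. The remaining factors move through `ψ` to become a
polynomial in `P(σ)` that vanishes at every `p_j`. -/
theorem aeval_nodal {ρ : H →L[ℂ] H} (hρ : ρ ∈ isospectral σ H) :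
    aeval ρ (Lagrange.nodal Finset.univ (node σ)) = 0 := by
  obtain ⟨ψ, hψ, rfl⟩ := exists_purification hρ
  have e : adjoint ψ ∘L ψ = charOp σ := hψ
  rw [Lagrange.nodal_eq, Fintype.prod_option, mul_comm, map_mul]
  have h0 : aeval (bundleProj ψ) (X - C (node σ none)) = ψ ∘L adjoint ψ := by
    simp [node, bundleProj]
  rw [h0, mul_def, ← comp_assoc, aeval_bundleProj_comp, e]
  have : ψ ∘L aeval (charOp σ) (∏ j, (X - C (node σ (some j)))) = 0 := by
    refine ext_on_ket fun i => ?_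
    rw [comp_apply, aeval_charOp_ket, eval_prod, Finset.prod_eq_zero (Finset.mem_univ i.1)]
    · simp
    · simp [node]
  rw [this, zero_comp]

variable {ρ : H →L[ℂ] H}

theorem sub_node_mul_spectralProj (hρ : ρ ∈ isospectral σ H) (i : Option (Fin σ.l)) :
    (ρ - node σ i • 1) * spectralProj σ ρ i = 0 := by
  have h : (X - C (node σ i)) * Lagrange.basis Finset.univ (node σ) i
      = C (Lagrange.nodalWeight Finset.univ (node σ) i) * Lagrange.nodal Finset.univ (node σ) := by
    rw [Lagrange.basis_eq_prod_sub_inv_mul_nodal_div (Finset.mem_univ i),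
      ← Lagrange.nodal_erase_eq_nodal_div (Finset.mem_univ i),
      Lagrange.nodal_eq_mul_nodal_erase (Finset.mem_univ i)]
    ring
  have h' := congrArg (aeval ρ) h
  rw [map_mul, map_mul, aeval_nodal hρ, mul_zero] at h'
  rw [← h', spectralProj]
  simp [Algebra.algebraMap_eq_smul_one]

theorem mul_spectralProj (hρ : ρ ∈ isospectral σ H) (i : Option (Fin σ.l)) :
    ρ * spectralProj σ ρ i = node σ i • spectralProj σ ρ i := by
  have := sub_node_mul_spectralProj hρ i
  rwa [sub_mul, smul_mul_assoc, one_mul, sub_eq_zero] at this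

theorem spectralProj_mul (hρ : ρ ∈ isospectral σ H) (i : Option (Fin σ.l)) :
    spectralProj σ ρ i * ρ = node σ i • spectralProj σ ρ i := by
  rw [← mul_spectralProj hρ]
  unfold spectralProj
  nth_rewrite 2 [← aeval_X (R := ℂ) ρ]
  nth_rewrite 3 [← aeval_X (R := ℂ) ρ]
  rw [← map_mul, ← map_mul, mul_comm]

omit [CompleteSpace H] in
theorem sum_spectralProj (ρ : H →L[ℂ] H) : ∑ i, spectralProj σ ρ i = 1 := by
  unfold spectralProj
  rw [← map_sum, Lagrange.sum_basis node_injective.injOn ⟨none, Finset.mem_univ _⟩, map_one]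

theorem spectralProj_mul_of_ne (hρ : ρ ∈ isospectral σ H) {i k : Option (Fin σ.l)} (h : i ≠ k) :
    spectralProj σ ρ i * spectralProj σ ρ k = 0 := by
  have h1 : node σ i • (spectralProj σ ρ i * spectralProj σ ρ k)
      = node σ k • (spectralProj σ ρ i * spectralProj σ ρ k) := by
    rw [← smul_mul_assoc, ← spectralProj_mul hρ, mul_assoc, mul_spectralProj hρ, mul_smul_comm]
  rw [← sub_eq_zero, ← sub_smul] at h1
  exact (smul_eq_zero.mp h1).resolve_left (sub_ne_zero.mpr (node_injective.ne h))

theorem spectralProj_mul_self (hρ : ρ ∈ isospectral σ H) (i : Option (Fin σ.l)) :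
    spectralProj σ ρ i * spectralProj σ ρ i = spectralProj σ ρ i := by
  have h := congrArg (spectralProj σ ρ i * ·) (sum_spectralProj (σ := σ) ρ)
  simp only [Finset.mul_sum, mul_one] at h
  rwa [Finset.sum_eq_single i (fun k _ hk => spectralProj_mul_of_ne hρ hk.symm) (by simp)] at h

theorem isSelfAdjoint_of_mem_isospectral (hρ : ρ ∈ isospectral σ H) : IsSelfAdjoint ρ :=
  hρ.1.isPositive.isSelfAdjoint

/-- Comparing eigenvalues gives `Eᵢ* Eₖ = 0` for `k ≠ i`. Summing over `k` yields `Eᵢ* = Eᵢ* Eᵢ`,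
which is self-adjoint. -/
theorem isSelfAdjoint_spectralProj (hρ : ρ ∈ isospectral σ H) (i : Option (Fin σ.l)) :
    IsSelfAdjoint (spectralProj σ ρ i) := by
  have hsa : star ρ = ρ := isSelfAdjoint_of_mem_isospectral hρ
  have h0 : star (spectralProj σ ρ i) * ρ = node σ i • star (spectralProj σ ρ i) := by
    have := congrArg star (mul_spectralProj hρ i)
    rwa [star_mul, star_smul, hsa, conj_node] at this
  have h1 (k) (hk : k ≠ i) : star (spectralProj σ ρ i) * spectralProj σ ρ k = 0 := by
    have h2 : node σ i • (star (spectralProj σ ρ i) * spectralProj σ ρ k)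
        = node σ k • (star (spectralProj σ ρ i) * spectralProj σ ρ k) := by
      rw [← smul_mul_assoc, ← h0, mul_assoc, mul_spectralProj hρ, mul_smul_comm]
    rw [← sub_eq_zero, ← sub_smul] at h2
    exact (smul_eq_zero.mp h2).resolve_left (sub_ne_zero.mpr (node_injective.ne hk.symm))
  have h := congrArg (star (spectralProj σ ρ i) * ·) (sum_spectralProj (σ := σ) ρ)
  simp only [Finset.mul_sum, mul_one] at h
  rw [Finset.sum_eq_single i (fun k _ hk => h1 k hk) (by simp)] at h
  have h3 := IsSelfAdjoint.star_mul_self (spectralProj σ ρ i)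
  rw [h] at h3
  exact star_star (spectralProj σ ρ i) ▸ h3.star_eq.symm ▸ h3

theorem spectralProj_ket {ψ : AuxSpace σ →L[ℂ] H} (hψ : ψ ∈ purifications σ H)
    (i : Σ j : Fin σ.l, Fin (σ.m j)) :
    spectralProj σ (bundleProj ψ) (some i.1) (ψ (ket σ i)) = ψ (ket σ i) := by
  have e : adjoint ψ ∘L ψ = charOp σ := hψ
  unfold spectralProj
  rw [← comp_apply, aeval_bundleProj_comp, e, comp_apply, aeval_charOp_ket]
  change ψ (eval (node σ (some i.1)) _ • _) = _
  rw [Lagrange.eval_basis_self node_injective.injOn (Finset.mem_univ _), one_smul]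

/-- This is the gain from defining spectral projections by Lagrange polynomials: they are `C¹`
functions of the state, so they can be differentiated along curves and yield continuous
Hamiltonians. -/
theorem contDiff_aeval (q : ℂ[X]) : ContDiff ℝ 1 fun ρ : H →L[ℂ] H => aeval ρ q := by
  induction q using Polynomial.induction_on' with
  | add p q hp hq => simpa using hp.add hq
  | monomial n a =>
    simp only [aeval_monomial]
    exact contDiff_const.mul (contDiff_id.pow n)

theorem contDiff_spectralProj (i : Option (Fin σ.l)) :
    ContDiff ℝ 1 fun ρ : H →L[ℂ] H => spectralProj σ ρ i :=
  contDiff_aeval _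

/-- The derivative of a curve in `D(σ)` has no diagonal blocks. -/
theorem spectralProj_deriv_spectralProj {s : Set ℝ} {γ : ℝ → H →L[ℂ] H} {γ' : H →L[ℂ] H} {t : ℝ}
    (hs : UniqueDiffWithinAt ℝ s t) (ht : t ∈ s) (hγ : ∀ u ∈ s, γ u ∈ isospectral σ H)
    (hd : HasDerivWithinAt γ γ' s t) (i : Option (Fin σ.l)) :
    spectralProj σ (γ t) i * γ' * spectralProj σ (γ t) i = 0 := by
  have hE : DifferentiableWithinAt ℝ (fun u => spectralProj σ (γ u) i) s t :=
    ((contDiff_spectralProj i).differentiable one_ne_zero).differentiableAt.comp_differentiableWithinAt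
      t hd.differentiableWithinAt
  -- Differentiate `(γ - pᵢ) Eᵢ(γ) = 0`. Multiplying by `Eᵢ` on the left removes the term containing
  -- the derivative of `Eᵢ`.
  have h1 := (hd.sub_const (node σ i • (1 : H →L[ℂ] H))).mul hE.hasDerivWithinAt
  have h2 : HasDerivWithinAt (fun u => (γ u - node σ i • (1 : H →L[ℂ] H)) *
      spectralProj σ (γ u) i) 0 s t :=
    (hasDerivWithinAt_const t s 0).congr (fun u hu => sub_node_mul_spectralProj (hγ u hu) i)
      (sub_node_mul_spectralProj (hγ t ht) i)
  have h3 := hs.eq_deriv s h1 h2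
  have h4 : spectralProj σ (γ t) i * (γ t - node σ i • (1 : H →L[ℂ] H)) = 0 := by
    rw [mul_sub, spectralProj_mul (hγ t ht), mul_smul_comm, mul_one, sub_self]
  have h5 := congrArg (spectralProj σ (γ t) i * ·) h3
  simp only [mul_add, mul_zero] at h5
  rw [← mul_assoc, ← mul_assoc, h4, zero_mul, add_zero] at h5
  exact h5

/-- The part of `A` without diagonal blocks with respect to the eigenspaces of `ρ`. -/
def offDiag (σ : DensitySpectrum) (ρ A : H →L[ℂ] H) : H →L[ℂ] H :=
  A - ∑ i, spectralProj σ ρ i * A * spectralProj σ ρ i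

theorem spectralProj_offDiag_spectralProj (hρ : ρ ∈ isospectral σ H) (A : H →L[ℂ] H)
    (i : Option (Fin σ.l)) :
    spectralProj σ ρ i * offDiag σ ρ A * spectralProj σ ρ i = 0 := by
  rw [offDiag, mul_sub, sub_mul, Finset.mul_sum, Finset.sum_mul, Finset.sum_eq_single i,
    ← mul_assoc, ← mul_assoc, spectralProj_mul_self hρ, mul_assoc (_ * A),
    spectralProj_mul_self hρ, sub_self]
  · intro k _ hk
    rw [← mul_assoc, ← mul_assoc, spectralProj_mul_of_ne hρ hk.symm]
    simp
  · simp

theorem isSelfAdjoint_offDiag (hρ : ρ ∈ isospectral σ H) {A : H →L[ℂ] H} (hA : IsSelfAdjoint A) :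
    IsSelfAdjoint (offDiag σ ρ A) := by
  refine hA.sub ?_
  rw [IsSelfAdjoint, star_sum]
  refine Finset.sum_congr rfl fun i _ => ?_
  rw [star_mul, star_mul, hA.star_eq, (isSelfAdjoint_spectralProj hρ i).star_eq, mul_assoc]

/-- The diagonal blocks commute with `ρ` and drop out of the commutator. -/
theorem vonNeumannField_offDiag (hρ : ρ ∈ isospectral σ H) (ℏ : ℝ) (A : H →L[ℂ] H) :
    vonNeumannField ℏ (offDiag σ ρ A) ρ = vonNeumannField ℏ A ρ := by
  unfold vonNeumannField
  congr 1
  change offDiag σ ρ A * ρ - ρ * offDiag σ ρ A = A * ρ - ρ * A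
  have h1 : (∑ i, spectralProj σ ρ i * A * spectralProj σ ρ i) * ρ
      = ρ * ∑ i, spectralProj σ ρ i * A * spectralProj σ ρ i := by
    rw [Finset.sum_mul, Finset.mul_sum]
    refine Finset.sum_congr rfl fun i _ => ?_
    rw [mul_assoc, spectralProj_mul hρ, ← mul_assoc, ← mul_assoc, mul_spectralProj hρ,
      mul_smul_comm, smul_mul_assoc, smul_mul_assoc]
  rw [offDiag, sub_mul, mul_sub, h1]
  abel

/-- The Hamiltonian without diagonal blocks that generates the tangent vector `D` at `ρ`. -/
def generator (σ : DensitySpectrum) (ℏ : ℝ) (ρ D : H →L[ℂ] H) : H →L[ℂ] H :=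
  (Complex.I * ℏ) • ∑ i, ∑ k, (node σ k - node σ i)⁻¹ • (spectralProj σ ρ i * D * spectralProj σ ρ k)

theorem isSelfAdjoint_generator (hρ : ρ ∈ isospectral σ H) (ℏ : ℝ) {D : H →L[ℂ] H}
    (hD : IsSelfAdjoint D) : IsSelfAdjoint (generator σ ℏ ρ D) := by
  unfold generator
  rw [IsSelfAdjoint, star_smul, star_sum]
  simp only [star_sum, star_smul, star_mul, hD.star_eq, (isSelfAdjoint_spectralProj hρ _).star_eq,
    star_inv₀, star_sub, conj_node]
  rw [Finset.sum_comm, Finset.smul_sum, Finset.smul_sum]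
  refine Finset.sum_congr rfl fun i _ => ?_
  rw [Finset.smul_sum, Finset.smul_sum]
  refine Finset.sum_congr rfl fun k _ => ?_
  rw [smul_smul, smul_smul, mul_assoc]
  congr 1
  rw [← neg_sub (node σ k), inv_neg]
  simp
  ring

/-- Terms with `i = k` in `generator` have coefficient `0⁻¹ = 0`, so they need not be excluded from
the sum. -/
theorem spectralProj_generator_spectralProj (hρ : ρ ∈ isospectral σ H) (ℏ : ℝ) (D : H →L[ℂ] H)
    (i : Option (Fin σ.l)) :
    spectralProj σ ρ i * generator σ ℏ ρ D * spectralProj σ ρ i = 0 := by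
  unfold generator
  rw [mul_smul_comm, smul_mul_assoc, Finset.mul_sum, Finset.sum_mul]
  rw [Finset.sum_eq_zero, smul_zero]
  intro a _
  rw [Finset.mul_sum, Finset.sum_mul]
  refine Finset.sum_eq_zero fun k _ => ?_
  rw [mul_smul_comm, smul_mul_assoc]
  by_cases ha : i = a
  · by_cases hk : k = i
    · rw [← ha, hk, sub_self, inv_zero, zero_smul]
    · rw [mul_assoc, mul_assoc _ _ (spectralProj σ ρ i), spectralProj_mul_of_ne hρ hk]
      simp
  · rw [← mul_assoc, ← mul_assoc, spectralProj_mul_of_ne hρ ha]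
    simp

/-- On the block `(i, k)` the commutator with `ρ` is multiplication by `node σ k - node σ i`, which
the coefficients of `generator` invert. The blocks where this fails are the diagonal ones, and there
`D` vanishes. -/
theorem vonNeumannField_generator (hρ : ρ ∈ isospectral σ H) {ℏ : ℝ} (hℏ : ℏ ≠ 0) {D : H →L[ℂ] H}
    (hD : ∀ i, spectralProj σ ρ i * D * spectralProj σ ρ i = 0) :
    vonNeumannField ℏ (generator σ ℏ ρ D) ρ = D := by
  have hc : Complex.I * (ℏ : ℂ) ≠ 0 := mul_ne_zero Complex.I_ne_zero (by exact_mod_cast hℏ)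
  unfold vonNeumannField
  change (1 / (Complex.I * ℏ)) • (generator σ ℏ ρ D * ρ - ρ * generator σ ℏ ρ D) = D
  unfold generator
  rw [smul_mul_assoc, mul_smul_comm, ← smul_sub, smul_smul, one_div, inv_mul_cancel₀ hc, one_smul]
  have h1 : D = ∑ i, ∑ k, spectralProj σ ρ i * D * spectralProj σ ρ k := by
    simp only [← Finset.mul_sum, ← Finset.sum_mul, sum_spectralProj, one_mul, mul_one]
  conv_rhs => rw [h1]
  rw [Finset.sum_mul, Finset.mul_sum, ← Finset.sum_sub_distrib]
  refine Finset.sum_congr rfl fun i _ => ?_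
  rw [Finset.sum_mul, Finset.mul_sum, ← Finset.sum_sub_distrib]
  refine Finset.sum_congr rfl fun k _ => ?_
  rw [smul_mul_assoc, mul_smul_comm, mul_assoc _ _ ρ, spectralProj_mul hρ, ← mul_assoc ρ,
    ← mul_assoc ρ, mul_spectralProj hρ, mul_smul_comm, smul_mul_assoc, smul_mul_assoc, ← smul_sub,
    ← sub_smul, smul_smul]
  by_cases h : k = i
  · rw [h, hD, smul_zero]
  · rw [inv_mul_cancel₀ (sub_ne_zero.mpr (node_injective.ne h)), one_smul]

end SpectralProjections

/-! ## The speed of von Neumann evolution -/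

section Speed

variable {H : Type*} [NormedAddCommGroup H] [InnerProductSpace ℂ H] [CompleteSpace H]
  {σ : DensitySpectrum}

/-- The velocity `ψ' = Aψ / (iħ)` of the Schrödinger evolution of `ψ`. -/
def schrodingerField (ℏ : ℝ) (A : H →L[ℂ] H) (ψ : AuxSpace σ →L[ℂ] H) : AuxSpace σ →L[ℂ] H :=
  (1 / (Complex.I * ℏ)) • (A ∘L ψ)

theorem star_inv_I_mul (ℏ : ℝ) :
    (starRingEnd ℂ) (1 / (Complex.I * ℏ)) = -(1 / (Complex.I * ℏ)) := by
  simp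

theorem adjoint_schrodingerField (ℏ : ℝ) {A : H →L[ℂ] H} (hA : IsSelfAdjoint A)
    (ψ : AuxSpace σ →L[ℂ] H) :
    adjoint (schrodingerField ℏ A ψ) = -(1 / (Complex.I * ℏ)) • (adjoint ψ ∘L A) := by
  have hA' : adjoint A = A := hA
  rw [schrodingerField, LinearIsometryEquiv.map_smulₛₗ, adjoint_comp, hA', star_inv_I_mul]

theorem projDiff_schrodingerField (ℏ : ℝ) {A : H →L[ℂ] H} (hA : IsSelfAdjoint A)
    (ψ : AuxSpace σ →L[ℂ] H) :
    projDiff ψ (schrodingerField ℏ A ψ) = vonNeumannField ℏ A (bundleProj ψ) := by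
  rw [projDiff, adjoint_schrodingerField ℏ hA, schrodingerField, vonNeumannField, bundleProj,
    smul_comp, comp_smul, neg_smul, smul_sub, ← sub_eq_add_neg]
  simp only [comp_assoc]

theorem schrodingerField_mem_tangentAt (ℏ : ℝ) {A : H →L[ℂ] H} (hA : IsSelfAdjoint A)
    (ψ : AuxSpace σ →L[ℂ] H) : schrodingerField ℏ A ψ ∈ tangentAt ψ := by
  change adjoint _ ∘L ψ + adjoint ψ ∘L _ = 0
  rw [adjoint_schrodingerField ℏ hA, schrodingerField, smul_comp, comp_smul, neg_smul, comp_assoc,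
    neg_add_cancel]

/-- Tangency and verticality together give `Vψ†ψ = -ψV†ψ = ψψ†V`. Thus `V` intertwines `P(σ)` with
`ρ` and maps each block into the matching eigenspace. -/
theorem ket_of_verticalAt {ψ V : AuxSpace σ →L[ℂ] H} (hψ : ψ ∈ purifications σ H)
    (hV : V ∈ verticalAt ψ) (i : Σ j : Fin σ.l, Fin (σ.m j)) :
    spectralProj σ (bundleProj ψ) (some i.1) (V (ket σ i)) = V (ket σ i) := by
  have e : adjoint ψ ∘L ψ = charOp σ := hψ
  obtain ⟨h1, h2⟩ := hV
  replace h1 : adjoint V ∘L ψ + adjoint ψ ∘L V = 0 := h1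
  replace h2 : V ∘L adjoint ψ + ψ ∘L adjoint V = 0 := h2
  have h3 : bundleProj ψ ∘L V = V ∘L charOp σ := by
    rw [← e, ← comp_assoc, eq_neg_of_add_eq_zero_left h2, bundleProj, comp_assoc,
      eq_neg_of_add_eq_zero_right h1, neg_comp, comp_neg, comp_assoc]
  have h4 : (bundleProj ψ - node σ (some i.1) • 1) (V (ket σ i)) = 0 := by
    have := DFunLike.congr_fun h3 (ket σ i)
    rw [comp_apply, comp_apply, charOp_ket, map_smul] at this
    rw [sub_apply, this]
    simp [node]
  have hρ := bundleProj_mem_isospectral hψ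
  have h5 (k) (hk : k ≠ some i.1) : spectralProj σ (bundleProj ψ) k (V (ket σ i)) = 0 := by
    have h6 := congrArg (spectralProj σ (bundleProj ψ) k) h4
    rw [map_zero, ← mul_apply_eq_comp, mul_sub, spectralProj_mul hρ, mul_smul_comm, mul_one,
      ← sub_smul, smul_apply] at h6
    exact (smul_eq_zero.mp h6).resolve_left (sub_ne_zero.mpr (node_injective.ne hk))
  have h7 := DFunLike.congr_fun (sum_spectralProj (σ := σ) (bundleProj ψ)) (V (ket σ i))
  rwa [sum_apply, Finset.sum_eq_single (some i.1) (fun k _ hk => h5 k hk) (by simp),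
    one_apply_eq_self] at h7

theorem inner_spectralProj_eq_zero {ρ B : H →L[ℂ] H} (hρ : ρ ∈ isospectral σ H)
    {i : Option (Fin σ.l)} (hB : spectralProj σ ρ i * B * spectralProj σ ρ i = 0) {x y : H}
    (hx : spectralProj σ ρ i x = x) (hy : spectralProj σ ρ i y = y) : inner ℂ x (B y) = 0 := by
  rw [← hx, ← hy, ← adjoint_inner_right, show adjoint _ = _ from isSelfAdjoint_spectralProj hρ i]
  have := DFunLike.congr_fun hB y
  rw [mul_apply_eq_comp, mul_apply_eq_comp, zero_apply] at this
  rw [this, inner_zero_right]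

/-- A vertical `V` and `ψ` itself send `ket σ i` into the same eigenspace, so each term of the inner
product is an entry of a diagonal block of `B`. -/
theorem schrodingerField_mem_horizontalAt (ℏ : ℝ) {ψ : AuxSpace σ →L[ℂ] H}
    (hψ : ψ ∈ purifications σ H) {B : H →L[ℂ] H} (hB : IsSelfAdjoint B)
    (hB0 : ∀ i, spectralProj σ (bundleProj ψ) i * B * spectralProj σ (bundleProj ψ) i = 0) :
    schrodingerField ℏ B ψ ∈ horizontalAt ψ := by
  refine ⟨schrodingerField_mem_tangentAt ℏ hB ψ, fun V hV => ?_⟩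
  rw [hsMetric_eq_sum]
  refine Finset.sum_eq_zero fun i _ => ?_
  have h := inner_spectralProj_eq_zero (bundleProj_mem_isospectral hψ) (hB0 (some i.1))
    (spectralProj_ket hψ i) (ket_of_verticalAt hψ hV i)
  have h' : inner ℂ (B (ψ (ket σ i))) (V (ket σ i)) = 0 := by
    rw [← h, ← adjoint_inner_right, show adjoint B = B from hB]
  simp [schrodingerField, inner_smul_left, h']

theorem hsMetric_schrodingerField {ℏ : ℝ} (A : H →L[ℂ] H) (ψ : AuxSpace σ →L[ℂ] H) :
    hsMetric (schrodingerField ℏ A ψ) (schrodingerField ℏ A ψ)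
      = (1 / ℏ) ^ 2 * ∑ i, ‖A (ψ (ket σ i))‖ ^ 2 := by
  rw [hsMetric_self_eq_sum, Finset.mul_sum]
  refine Finset.sum_congr rfl fun i _ => ?_
  simp [schrodingerField, norm_smul, mul_pow]

theorem orbitMetric_vonNeumannField (ℏ : ℝ) {ψ : AuxSpace σ →L[ℂ] H}
    (hψ : ψ ∈ purifications σ H) {B : H →L[ℂ] H} (hB : IsSelfAdjoint B)
    (hB0 : ∀ i, spectralProj σ (bundleProj ψ) i * B * spectralProj σ (bundleProj ψ) i = 0) :
    orbitMetric σ (bundleProj ψ) (vonNeumannField ℏ B (bundleProj ψ))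
      (vonNeumannField ℏ B (bundleProj ψ)) = (1 / ℏ) ^ 2 * ∑ i, ‖B (ψ (ket σ i))‖ ^ 2 := by
  have h := schrodingerField_mem_horizontalAt ℏ hψ hB hB0
  rw [← projDiff_schrodingerField ℏ hB, orbitMetric_eq hψ h h, hsMetric_schrodingerField]

theorem opTrace_comp_bundleProj (A : H →L[ℂ] H) (ψ : AuxSpace σ →L[ℂ] H) :
    opTrace (A ∘L bundleProj ψ) = ∑ i, inner ℂ (ψ (ket σ i)) (A (ψ (ket σ i))) := by
  rw [bundleProj, ← comp_assoc, opTrace_comp_adjoint]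
  rfl

theorem uncertainty_bundleProj {A : H →L[ℂ] H} (hA : IsSelfAdjoint A) (ψ : AuxSpace σ →L[ℂ] H) :
    uncertainty A (bundleProj ψ) = √(∑ i, ‖A (ψ (ket σ i))‖ ^ 2
      - (∑ i, (inner ℂ (ψ (ket σ i)) (A (ψ (ket σ i)))).re) ^ 2) := by
  unfold uncertainty
  rw [← comp_assoc, opTrace_comp_bundleProj, opTrace_comp_bundleProj, Complex.re_sum,
    Complex.re_sum]
  congr 2
  refine Finset.sum_congr rfl fun i _ => ?_
  rw [comp_apply, ← adjoint_inner_left, show adjoint A = A from hA]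
  exact inner_self_eq_norm_sq (𝕜 := ℂ) _

/-- The expectation of `B` is a sum of entries of its diagonal blocks, hence zero, and the variance
is the second moment. -/
theorem sqrt_orbitMetric_eq {ℏ : ℝ} (hℏ : 0 < ℏ) {ρ : H →L[ℂ] H} (hρ : ρ ∈ isospectral σ H)
    {B : H →L[ℂ] H} (hB : IsSelfAdjoint B)
    (hB0 : ∀ i, spectralProj σ ρ i * B * spectralProj σ ρ i = 0) :
    √(orbitMetric σ ρ (vonNeumannField ℏ B ρ) (vonNeumannField ℏ B ρ))
      = 1 / ℏ * uncertainty B ρ := by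
  obtain ⟨ψ, hψ, rfl⟩ := exists_purification hρ
  rw [orbitMetric_vonNeumannField ℏ hψ hB hB0, uncertainty_bundleProj hB, Real.sqrt_mul (by positivity),
    Real.sqrt_sq (by positivity)]
  have (i : Σ j : Fin σ.l, Fin (σ.m j)) : inner ℂ (ψ (ket σ i)) (B (ψ (ket σ i))) = 0 :=
    inner_spectralProj_eq_zero hρ (hB0 (some i.1)) (spectralProj_ket hψ i) (spectralProj_ket hψ i)
  simp [this]

/-- The variance as a second moment about the mean, using `∑ ‖ψeᵢ‖² = 1`. It lets `A` and its
off-diagonal part be compared term by term. -/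
theorem sum_norm_sq_sub_smul {ψ : AuxSpace σ →L[ℂ] H} (hψ : ψ ∈ purifications σ H)
    (A : H →L[ℂ] H) (a : ℝ) (ha : a = ∑ i, (inner ℂ (ψ (ket σ i)) (A (ψ (ket σ i)))).re) :
    ∑ i, ‖A (ψ (ket σ i)) - (a : ℂ) • ψ (ket σ i)‖ ^ 2 = ∑ i, ‖A (ψ (ket σ i))‖ ^ 2 - a ^ 2 := by
  have h1 : ∑ i, ‖ψ (ket σ i)‖ ^ 2 = 1 := by
    rw [← hsMetric_self_eq_sum, hsMetric_purification hψ]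
  have h2 (x y : H) : ‖y - (a : ℂ) • x‖ ^ 2 = ‖y‖ ^ 2 - 2 * a * (inner ℂ x y).re + a ^ 2 * ‖x‖ ^ 2 := by
    rw [norm_sub_sq (𝕜 := ℂ), inner_smul_right, norm_smul, mul_pow]
    have := inner_re_symm (𝕜 := ℂ) y x
    simp only [RCLike.re_to_complex] at this
    simp [this]
    ring
  simp only [h2]
  rw [Finset.sum_add_distrib, Finset.sum_sub_distrib, ← Finset.mul_sum, ← Finset.mul_sum, h1, ← ha]
  ring

/-- The speed of a von Neumann evolution is at most `ΔH / ħ`. -/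
theorem sqrt_orbitMetric_le {ℏ : ℝ} (hℏ : 0 < ℏ) {ρ : H →L[ℂ] H} (hρ : ρ ∈ isospectral σ H)
    {A : H →L[ℂ] H} (hA : IsSelfAdjoint A) :
    √(orbitMetric σ ρ (vonNeumannField ℏ A ρ) (vonNeumannField ℏ A ρ))
      ≤ 1 / ℏ * uncertainty A ρ := by
  have hB0 := spectralProj_offDiag_spectralProj hρ A
  have hB := isSelfAdjoint_offDiag hρ hA
  rw [← vonNeumannField_offDiag hρ]
  obtain ⟨ψ, hψ, rfl⟩ := exists_purification hρ
  rw [orbitMetric_vonNeumannField ℏ hψ hB hB0, uncertainty_bundleProj hA,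
    ← sum_norm_sq_sub_smul hψ A _ rfl, Real.sqrt_mul (by positivity), Real.sqrt_sq (by positivity)]
  generalize ∑ i, (inner ℂ (ψ (ket σ i)) (A (ψ (ket σ i)))).re = a
  gcongr with i _
  set B := offDiag σ (bundleProj ψ) A with hBdef
  set Q := spectralProj σ (bundleProj ψ) (some i.1) with hQ
  have hx : Q (ψ (ket σ i)) = ψ (ket σ i) := spectralProj_ket hψ i
  generalize ψ (ket σ i) = x at hx
  -- The second summand is in the eigenspace of `x` and `B x` is orthogonal to that eigenspace, so
  -- Pythagoras applies.
  have hdiff : A x - (a : ℂ) • x = B x + (Q (A x) - (a : ℂ) • x) := by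
    have hk (k) (hk : k ≠ some i.1) : spectralProj σ (bundleProj ψ) k x = 0 := by
      rw [← hx, ← mul_apply_eq_comp, spectralProj_mul_of_ne hρ hk, zero_apply]
    rw [hBdef, offDiag, sub_apply, sum_apply, Finset.sum_eq_single (some i.1), mul_apply_eq_comp,
      ← hQ, hx, mul_apply_eq_comp]
    · abel
    · intro k _ hne
      rw [mul_apply_eq_comp, hk k hne, map_zero]
    · simp
  have horth : inner ℂ (Q (A x) - (a : ℂ) • x) (B x) = 0 := by
    refine inner_spectralProj_eq_zero hρ (hB0 (some i.1)) ?_ hx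
    rw [map_sub, map_smul, ← hQ, hx, ← mul_apply_eq_comp, spectralProj_mul_self hρ]
  rw [hdiff]
  have h := norm_add_pow_two (𝕜 := ℂ) (Q (A x) - (a : ℂ) • x) (B x)
  rw [horth, add_comm (Q (A x) - _)] at h
  rw [← abs_norm, ← abs_norm (B x + _), ← sq_le_sq, h]
  simp

theorem uncertainty_smul {c : ℝ} (hc : 0 ≤ c) (A ρ : H →L[ℂ] H) :
    uncertainty ((c : ℂ) • A) ρ = c * uncertainty A ρ := by
  have h (z : ℂ) (T : H →L[ℂ] H) : opTrace (z • T) = z * opTrace T := by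
    unfold opTrace
    rw [← tsum_mul_left]
    exact tsum_congr fun e => by simp [diagCoeff]
  unfold uncertainty
  rw [smul_comp, smul_comp, comp_smul, h, h, h, Complex.re_ofReal_mul,
    Complex.re_ofReal_mul, Complex.re_ofReal_mul]
  rw [show ∀ x y : ℝ, c * (c * x) - (c * y) ^ 2 = c ^ 2 * (x - y ^ 2) by intros; ring,
    Real.sqrt_mul (sq_nonneg c), Real.sqrt_sq hc]

end Speed

/-! ## Linear evolution equations -/

section LinearODE

variable {E : Type*} [NormedAddCommGroup E] [NormedSpace ℂ E] [CompleteSpace E]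

/-- The terms of the Dyson series of the evolution equation `x' = B(t)x`, `x(0) = x₀`. -/
def dysonTerm (B : ℝ → E →L[ℂ] E) (x₀ : E) : ℕ → ℝ → E
  | 0 => fun _ => x₀
  | n + 1 => fun t => ∫ s in (0 : ℝ)..t, B s (dysonTerm B x₀ n s)

variable {B : ℝ → E →L[ℂ] E} {x₀ : E}

omit [CompleteSpace E] in
theorem continuous_dysonTerm (hB : Continuous B) (n : ℕ) : Continuous (dysonTerm B x₀ n) := by
  induction n with
  | zero => exact continuous_const
  | succ n ih =>
    exact intervalIntegral.continuous_primitive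
      (fun a b => (hB.clm_apply ih).intervalIntegrable a b) 0

theorem hasDerivAt_dysonTerm_succ (hB : Continuous B) (n : ℕ) (t : ℝ) :
    HasDerivAt (dysonTerm B x₀ (n + 1)) (B t (dysonTerm B x₀ n t)) t := by
  have hc : Continuous fun s => B s (dysonTerm B x₀ n s) :=
    hB.clm_apply (continuous_dysonTerm hB n)
  exact intervalIntegral.integral_hasDerivAt_right (hc.intervalIntegrable 0 t)
    (hc.stronglyMeasurableAtFilter _ _) hc.continuousAt

omit [CompleteSpace E] in
-- Each integration raises the power of `|t|` and supplies the next factor of the factorial.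
-- Negative `t` is included because the series is later differentiated on an open interval around
-- `[0, τ]`.
theorem norm_dysonTerm_le (hB : Continuous B) {M : ℝ} (hM : ∀ t, ‖B t‖ ≤ M) (n : ℕ) (t : ℝ) :
    ‖dysonTerm B x₀ n t‖ ≤ ‖x₀‖ * ((M * |t|) ^ n / n.factorial) := by
  have hM0 : 0 ≤ M := (norm_nonneg _).trans (hM 0)
  induction n generalizing t with
  | zero => simp [dysonTerm]
  | succ n ih =>
    have hc : Continuous fun s => B s (dysonTerm B x₀ n s) :=
      hB.clm_apply (continuous_dysonTerm hB n)
    calc ‖dysonTerm B x₀ (n + 1) t‖ ≤ ∫ s in Set.uIoc 0 t, ‖B s (dysonTerm B x₀ n s)‖ :=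
          intervalIntegral.norm_integral_le_integral_norm_uIoc
      _ ≤ ∫ s in Set.uIoc 0 t, M * (‖x₀‖ * (M ^ n / n.factorial)) * |s - 0| ^ n := by
          refine MeasureTheory.setIntegral_mono_on ?_ ?_ measurableSet_uIoc fun s _ => ?_
          · exact intervalIntegrable_iff.mp (hc.norm.intervalIntegrable 0 t)
          · refine intervalIntegrable_iff.mp (Continuous.intervalIntegrable ?_ 0 t)
            fun_prop
          · calc ‖B s (dysonTerm B x₀ n s)‖ ≤ M * (‖x₀‖ * ((M * |s|) ^ n / n.factorial)) :=
                  (B s).le_of_opNorm_le_of_le (hM s) (ih s)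
              _ = _ := by rw [mul_pow, sub_zero]; ring
      _ = _ := by
          rw [MeasureTheory.integral_const_mul, integral_pow_abs_sub_uIoc, sub_zero, mul_pow,
            Nat.factorial_succ]
          push_cast
          field_simp
          ring

theorem exists_linear_evolution (hB : Continuous B) {M : ℝ} (hM : ∀ t, ‖B t‖ ≤ M) (x₀ : E)
    (τ : ℝ) : ∃ x : ℝ → E, x 0 = x₀ ∧ ∀ t ∈ Set.Icc 0 τ, HasDerivAt x (B t (x t)) t := by
  have hM0 : 0 ≤ M := (norm_nonneg _).trans (hM 0)
  have hsum (t : ℝ) : Summable fun n => dysonTerm B x₀ n t :=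
    Summable.of_norm_bounded ((Real.summable_pow_div_factorial _).mul_left _)
      fun n => norm_dysonTerm_le hB hM n t
  have hsplit (t : ℝ) : ∑' n, dysonTerm B x₀ n t = x₀ + ∑' n, dysonTerm B x₀ (n + 1) t :=
    (hsum t).tsum_eq_zero_add
  -- With the constant term split off, the derivative of each remaining term is `B` applied to its
  -- predecessor, so termwise differentiation reproduces the whole series.
  refine ⟨fun t => x₀ + ∑' n, dysonTerm B x₀ (n + 1) t, ?_, fun t ht => ?_⟩
  · simp [dysonTerm]
  · change HasDerivAt _ (B t (x₀ + ∑' n, dysonTerm B x₀ (n + 1) t)) t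
    rw [← hsplit, (B t).map_tsum (hsum t)]
    refine HasDerivAt.const_add _ ?_
    have hu : Summable fun n : ℕ => M * (‖x₀‖ * ((M * (τ + 1)) ^ n / n.factorial)) := by
      have := Real.summable_pow_div_factorial (M * (τ + 1))
      exact (this.mul_left ‖x₀‖).mul_left M
    refine hasDerivAt_tsum_of_isPreconnected (t := Set.Ioo (-(τ + 1)) (τ + 1)) (y₀ := 0)
      hu isOpen_Ioo isPreconnected_Ioo
      (fun n y _ => hasDerivAt_dysonTerm_succ hB n y) (fun n y hy => ?_) ?_
      ((summable_nat_add_iff 1).mpr (hsum 0)) ?_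
    · refine (B y).le_of_opNorm_le_of_le (hM y) ((norm_dysonTerm_le hB hM n y).trans ?_)
      have : |y| ≤ τ + 1 := (abs_lt.mpr hy).le
      gcongr
    · constructor <;> linarith [ht.1, ht.2]
    · constructor <;> linarith [ht.1, ht.2]

end LinearODE

/-! ## Lifts of von Neumann evolutions -/

section Lift

variable {H : Type*} [NormedAddCommGroup H] [InnerProductSpace ℂ H] [CompleteSpace H]
  {σ : DensitySpectrum}

theorem hasDerivWithinAt_comp {E F G : Type*} [NormedAddCommGroup E] [NormedSpace ℂ E]
    [NormedAddCommGroup F] [NormedSpace ℂ F] [NormedAddCommGroup G] [NormedSpace ℂ G]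
    {X : ℝ → F →L[ℂ] G} {Y : ℝ → E →L[ℂ] F} {X' : F →L[ℂ] G} {Y' : E →L[ℂ] F} {s : Set ℝ} {t : ℝ}
    (hX : HasDerivWithinAt X X' s t) (hY : HasDerivWithinAt Y Y' s t) :
    HasDerivWithinAt (fun u => X u ∘L Y u) (X t ∘L Y' + X' ∘L Y t) s t := by
  have hb : IsBoundedBilinearMap ℝ fun p : (F →L[ℂ] G) × (E →L[ℂ] F) => p.1 ∘L p.2 :=
    { add_left := fun x y z => add_comp x y z
      smul_left := fun c x y => by ext; simp
      add_right := fun x y z => comp_add x y z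
      smul_right := fun c x y => by ext; simp
      bound := ⟨1, one_pos, fun x y => by rw [one_mul]; exact opNorm_comp_le x y⟩ }
  exact (hb.hasFDerivAt (X t, Y t)).comp_hasDerivWithinAt t (hX.prodMk hY)

theorem hasDerivWithinAt_adjoint {E F : Type*} [NormedAddCommGroup E] [InnerProductSpace ℂ E]
    [CompleteSpace E] [NormedAddCommGroup F] [InnerProductSpace ℂ F] [CompleteSpace F]
    {X : ℝ → E →L[ℂ] F} {X' : E →L[ℂ] F} {s : Set ℝ} {t : ℝ} (hX : HasDerivWithinAt X X' s t) :
    HasDerivWithinAt (fun u => adjoint (X u)) (adjoint X') s t := by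
  have hb : IsBoundedLinearMap ℝ fun X : E →L[ℂ] F => adjoint X :=
    { map_add := fun x y => map_add _ x y
      map_smul := fun c x => by
        have := LinearIsometryEquiv.map_smulₛₗ (adjoint : (E →L[ℂ] F) ≃ₗᵢ⋆[ℂ] _) (c : ℂ) x
        rwa [Complex.conj_ofReal, Complex.coe_smul, Complex.coe_smul] at this
      bound := ⟨1, one_pos, fun x => by rw [one_mul]; exact (LinearIsometryEquiv.norm_map _ x).le⟩ }
  exact hb.hasFDerivAt.comp_hasDerivWithinAt t hX

theorem hasDerivWithinAt_bundleProj {ψ : ℝ → AuxSpace σ →L[ℂ] H} {ψ' : AuxSpace σ →L[ℂ] H}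
    {s : Set ℝ} {t : ℝ} (h : HasDerivWithinAt ψ ψ' s t) :
    HasDerivWithinAt (fun u => bundleProj (ψ u)) (projDiff (ψ t) ψ') s t := by
  have := hasDerivWithinAt_comp h (hasDerivWithinAt_adjoint h)
  rwa [add_comm] at this

/-- Tangency says that `ψ†ψ` has derivative zero, so it keeps its initial value `P(σ)`. -/
theorem mem_purifications_of_hasDerivWithinAt {τ : ℝ} {ψ ψ' : ℝ → AuxSpace σ →L[ℂ] H}
    (h : ∀ t ∈ Set.Icc 0 τ, HasDerivWithinAt ψ (ψ' t) (Set.Icc 0 τ) t)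
    (h0 : ψ 0 ∈ purifications σ H) (ht : ∀ t ∈ Set.Icc 0 τ, ψ' t ∈ tangentAt (ψ t)) :
    ∀ t ∈ Set.Icc 0 τ, ψ t ∈ purifications σ H := by
  have hd : ∀ t ∈ Set.Icc 0 τ,
      HasDerivWithinAt (fun u => adjoint (ψ u) ∘L ψ u) 0 (Set.Icc 0 τ) t := by
    intro t hts
    have h1 := hasDerivWithinAt_comp (hasDerivWithinAt_adjoint (h t hts)) (h t hts)
    have h2 : adjoint (ψ' t) ∘L ψ t + adjoint (ψ t) ∘L ψ' t = 0 := ht t hts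
    rwa [add_comm, h2] at h1
  intro t hts
  have hτ : (0 : ℝ) ≤ τ := hts.1.trans hts.2
  have h3 := (convex_Icc (0 : ℝ) τ).norm_image_sub_le_of_norm_hasDerivWithin_le (C := 0) hd
    (fun _ _ => by simp) (Set.left_mem_Icc.mpr hτ) hts
  rw [zero_mul, norm_le_zero_iff, sub_eq_zero] at h3
  exact h3.trans h0

omit [CompleteSpace H] in
theorem vonNeumannField_sub (ℏ : ℝ) (A ρ ρ' : H →L[ℂ] H) :
    vonNeumannField ℏ A (ρ - ρ') = vonNeumannField ℏ A ρ - vonNeumannField ℏ A ρ' := by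
  simp only [vonNeumannField, comp_sub, sub_comp, ← smul_sub]
  congr 1
  abel

theorem norm_vonNeumannField_le (ℏ : ℝ) (A ρ : H →L[ℂ] H) :
    ‖vonNeumannField ℏ A ρ‖ ≤ ‖1 / (Complex.I * (ℏ : ℂ))‖ * (2 * ‖A‖) * ‖ρ‖ := by
  rw [vonNeumannField, norm_smul, mul_assoc]
  gcongr
  calc ‖A ∘L ρ - ρ ∘L A‖ ≤ ‖A ∘L ρ‖ + ‖ρ ∘L A‖ := norm_sub_le _ _
    _ ≤ ‖A‖ * ‖ρ‖ + ‖ρ‖ * ‖A‖ := add_le_add (opNorm_comp_le _ _) (opNorm_comp_le _ _)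
    _ = 2 * ‖A‖ * ‖ρ‖ := by ring

/-- A solution of the von Neumann equation lifts to a solution of the Schrödinger equation. -/
theorem exists_schrodinger_lift {ℏ τ : ℝ} {A ρ : ℝ → H →L[ℂ] H} {ρ₀ ρ₁ : H →L[ℂ] H}
    (hτ : 0 ≤ τ) (hA : IsHamiltonian τ A) (hρ : IsVonNeumannSolution ℏ τ A ρ₀ ρ₁ ρ)
    {ψ₀ : AuxSpace σ →L[ℂ] H} (hψ₀ : ψ₀ ∈ purifications σ H) (hψρ : bundleProj ψ₀ = ρ₀) :
    ∃ ψ : ℝ → AuxSpace σ →L[ℂ] H, ψ 0 = ψ₀ ∧ ∀ t ∈ Set.Icc 0 τ,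
      ψ t ∈ purifications σ H ∧ bundleProj (ψ t) = ρ t ∧
      HasDerivWithinAt ψ (schrodingerField ℏ (A t) (ψ t)) (Set.Icc 0 τ) t := by
  obtain ⟨C, hC⟩ := isCompact_Icc.exists_bound_of_continuousOn hA.continuousOn
  have hC0 : 0 ≤ C := (norm_nonneg _).trans (hC 0 (Set.left_mem_Icc.mpr hτ))
  -- Extending by the endpoint values gives a bounded continuous curve on all of `ℝ`, as the Dyson
  -- series requires.
  let A' : ℝ → H →L[ℂ] H := Set.IccExtend hτ (Set.domRestrict (Set.Icc 0 τ) A)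
  have hA' : Continuous A' := (continuousOn_iff_continuous_domRestrict.mp hA.continuousOn).Icc_extend'
  have hA'eq (t) (ht : t ∈ Set.Icc 0 τ) : A' t = A t := Set.IccExtend_of_mem hτ _ ht
  have hA'C (t) : ‖A' t‖ ≤ C := hC _ (Set.projIcc 0 τ hτ t).2
  let Φ := compL ℂ (AuxSpace σ) H H
  let B : ℝ → (AuxSpace σ →L[ℂ] H) →L[ℂ] (AuxSpace σ →L[ℂ] H) :=
    fun t => (1 / (Complex.I * ℏ)) • Φ (A' t)
  have hB : Continuous B := (Φ.continuous.comp hA').const_smul (1 / (Complex.I * ℏ) : ℂ)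
  obtain ⟨ψ, h0, hd⟩ := exists_linear_evolution hB
    (M := ‖1 / (Complex.I * (ℏ : ℂ))‖ * C) (fun t => by
      refine opNorm_le_bound _ (by positivity) fun X => ?_
      change ‖(1 / (Complex.I * (ℏ : ℂ))) • (A' t ∘L X)‖ ≤ _
      rw [norm_smul, mul_assoc]
      gcongr
      exact (opNorm_comp_le _ _).trans (mul_le_mul_of_nonneg_right (hA'C t) (norm_nonneg _))) ψ₀ τ
  have hd' (t) (ht : t ∈ Set.Icc 0 τ) :
      HasDerivWithinAt ψ (schrodingerField ℏ (A t) (ψ t)) (Set.Icc 0 τ) t := by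
    rw [← hA'eq t ht]
    exact (hd t ht).hasDerivWithinAt
  have hmem := mem_purifications_of_hasDerivWithinAt hd' (h0 ▸ hψ₀)
    fun t ht => schrodingerField_mem_tangentAt ℏ (hA.isSelfAdjoint t ht) (ψ t)
  have hdiff (t) (ht : t ∈ Set.Icc 0 τ) : HasDerivWithinAt (fun u => bundleProj (ψ u) - ρ u)
      (vonNeumannField ℏ (A t) (bundleProj (ψ t) - ρ t)) (Set.Icc 0 τ) t := by
    rw [vonNeumannField_sub, ← projDiff_schrodingerField ℏ (hA.isSelfAdjoint t ht)]
    exact (hasDerivWithinAt_bundleProj (hd' t ht)).sub (hρ.hasDeriv t ht)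
  -- Both `ψψ†` and `ρ` solve the same linear equation with the same initial value, so Grönwall's
  -- inequality makes them equal.
  have hzero := eq_zero_of_abs_deriv_le_mul_abs_self_of_eq_zero_right
    (K := ‖1 / (Complex.I * (ℏ : ℂ))‖ * (2 * C))
    (fun t ht => (hdiff t ht).continuousWithinAt)
    (fun t ht => (hdiff t (Set.Ico_subset_Icc_self ht)).mono_of_mem_nhdsWithin
      (Icc_mem_nhdsGE_of_mem ht))
    (by rw [h0, hψρ, hρ.initial, sub_self])
    (fun t ht => (norm_vonNeumannField_le _ _ _).trans (by
      have := hC t (Set.Ico_subset_Icc_self ht)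
      gcongr))
  exact ⟨ψ, h0, fun t ht => ⟨hmem t ht, sub_eq_zero.mp (hzero t ht), hd' t ht⟩⟩

end Lift

/-! ## Length and energy dispersion -/

section Dispersion

variable {H : Type*} [NormedAddCommGroup H] [InnerProductSpace ℂ H] [CompleteSpace H]
  {σ : DensitySpectrum} {ℏ τ : ℝ} {A ρ : ℝ → H →L[ℂ] H} {ρ₀ ρ₁ : H →L[ℂ] H}

theorem contDiffOn_one_of_hasDerivWithinAt {E : Type*} [NormedAddCommGroup E] [NormedSpace ℝ E]
    {f f' : ℝ → E} (hτ : 0 < τ)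
    (hd : ∀ t ∈ Set.Icc 0 τ, HasDerivWithinAt f (f' t) (Set.Icc 0 τ) t)
    (hc : ContinuousOn f' (Set.Icc 0 τ)) : ContDiffOn ℝ 1 f (Set.Icc 0 τ) := by
  have hu := uniqueDiffOn_Icc hτ
  rw [contDiffOn_one_iff_derivWithin hu]
  exact ⟨fun t ht => (hd t ht).differentiableWithinAt,
    hc.congr fun t ht => (hd t ht).derivWithin (hu t ht)⟩

theorem isCurveIn_of_isVonNeumannSolution (hτ : 0 < τ) (hA : IsHamiltonian τ A)
    (hρ : IsVonNeumannSolution ℏ τ A ρ₀ ρ₁ ρ) (hρ₀ : ρ₀ ∈ isospectral σ H) :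
    IsCurveIn σ ρ₀ ρ₁ τ ρ := by
  obtain ⟨ψ₀, hψ₀, hψρ⟩ := exists_purification hρ₀
  obtain ⟨ψ, -, hψ⟩ := exists_schrodinger_lift hτ.le hA hρ hψ₀ hψρ
  refine ⟨contDiffOn_one_of_hasDerivWithinAt hτ hρ.hasDeriv ?_, fun t ht => ?_, hρ.initial, hρ.final⟩
  · have hc : ContinuousOn ρ (Set.Icc 0 τ) := fun t ht => (hρ.hasDeriv t ht).continuousWithinAt
    exact ((hA.continuousOn.clm_comp hc).sub (hc.clm_comp hA.continuousOn)).const_smul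
      (1 / (Complex.I * ℏ) : ℂ)
  · rw [← (hψ t ht).2.1]
    exact bundleProj_mem_isospectral (hψ t ht).1

/-- Along a Schrödinger lift the traces in `uncertainty` are finite sums of continuous functions. -/
theorem continuousOn_uncertainty (hτ : 0 < τ) (hA : IsHamiltonian τ A)
    (hρ : IsVonNeumannSolution ℏ τ A ρ₀ ρ₁ ρ) (hρ₀ : ρ₀ ∈ isospectral σ H) :
    ContinuousOn (fun t => uncertainty (A t) (ρ t)) (Set.Icc 0 τ) := by
  obtain ⟨ψ₀, hψ₀, hψρ⟩ := exists_purification hρ₀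
  obtain ⟨ψ, -, hψ⟩ := exists_schrodinger_lift hτ.le hA hρ hψ₀ hψρ
  have hc : ContinuousOn ψ (Set.Icc 0 τ) := fun t ht => (hψ t ht).2.2.continuousWithinAt
  have h1 (i) : ContinuousOn (fun t => ψ t (ket σ i)) (Set.Icc 0 τ) :=
    hc.clm_apply continuousOn_const
  have h2 (i) : ContinuousOn (fun t => A t (ψ t (ket σ i))) (Set.Icc 0 τ) :=
    hA.continuousOn.clm_apply (h1 i)
  refine ContinuousOn.congr (f := fun t => √(∑ i, ‖A t (ψ t (ket σ i))‖ ^ 2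
      - (∑ i, (inner ℂ (ψ t (ket σ i)) (A t (ψ t (ket σ i)))).re) ^ 2)) ?_ fun t ht => ?_
  · refine ContinuousOn.sqrt (ContinuousOn.sub ?_ (ContinuousOn.pow ?_ 2))
    · exact continuousOn_finsetSum _ fun i _ => (h2 i).norm.pow 2
    · exact continuousOn_finsetSum _ fun i _ =>
        Complex.continuous_re.comp_continuousOn (ContinuousOn.inner (𝕜 := ℂ) (h1 i) (h2 i))
  · rw [← (hψ t ht).2.1, uncertainty_bundleProj (hA.isSelfAdjoint t ht)]

theorem curveLength_le_energyDispersion (hℏ : 0 < ℏ) (hτ : 0 < τ) (hA : IsHamiltonian τ A)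
    (hρ : IsVonNeumannSolution ℏ τ A ρ₀ ρ₁ ρ) (hρ₀ : ρ₀ ∈ isospectral σ H) :
    curveLength σ τ ρ ≤ energyDispersion ℏ τ A ρ := by
  have hcurve := isCurveIn_of_isVonNeumannSolution hτ hA hρ hρ₀
  have hc := continuousOn_uncertainty hτ hA hρ hρ₀
  rw [curveLength, energyDispersion, ← intervalIntegral.integral_const_mul,
    intervalIntegral.integral_of_le hτ.le, intervalIntegral.integral_of_le hτ.le]
  -- Only the larger integrand has to be integrable, so no regularity of the speed is needed.
  refine MeasureTheory.integral_mono_of_nonneg (Filter.Eventually.of_forall fun t =>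
    Real.sqrt_nonneg _) ?_ ?_
  · exact ((continuousOn_const.mul hc).integrableOn_Icc).mono_set Set.Ioc_subset_Icc_self
  · refine (MeasureTheory.ae_restrict_iff' measurableSet_Ioc).mpr
      (Filter.Eventually.of_forall fun t ht => ?_)
    have ht' := Set.Ioc_subset_Icc_self ht
    simp only
    rw [(hρ.hasDeriv t ht').derivWithin (uniqueDiffOn_Icc hτ t ht')]
    exact sqrt_orbitMetric_le hℏ (hcurve.mem t ht') (hA.isSelfAdjoint t ht')

theorem continuous_spectralProj (i : Option (Fin σ.l)) :
    Continuous fun ρ : H →L[ℂ] H => spectralProj σ ρ i :=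
  (contDiff_spectralProj i).continuous

/-- Every curve in `D(σ)` is driven by a Hamiltonian without diagonal blocks. -/
theorem exists_hamiltonian_of_isCurveIn (hℏ : 0 < ℏ) (hτ : 0 < τ) (hρ : IsCurveIn σ ρ₀ ρ₁ τ ρ) :
    ∃ A : ℝ → H →L[ℂ] H, IsHamiltonian τ A ∧ IsVonNeumannSolution ℏ τ A ρ₀ ρ₁ ρ ∧
      (∀ t ∈ Set.Icc 0 τ, ∀ i, spectralProj σ (ρ t) i * A t * spectralProj σ (ρ t) i = 0) ∧
      curveLength σ τ ρ = energyDispersion ℏ τ A ρ := by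
  have hu := uniqueDiffOn_Icc hτ
  set D : ℝ → H →L[ℂ] H := derivWithin ρ (Set.Icc 0 τ) with hD
  have hd (t) (ht : t ∈ Set.Icc 0 τ) : HasDerivWithinAt ρ (D t) (Set.Icc 0 τ) t :=
    ((hρ.contDiffOn.differentiableOn one_ne_zero) t ht).hasDerivWithinAt
  have hDc : ContinuousOn D (Set.Icc 0 τ) := hρ.contDiffOn.continuousOn_derivWithin hu le_rfl
  have hDsa (t) (ht : t ∈ Set.Icc 0 τ) : IsSelfAdjoint (D t) := by
    have h1 : HasDerivWithinAt ρ (adjoint (D t)) (Set.Icc 0 τ) t :=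
      (hasDerivWithinAt_adjoint (hd t ht)).congr
        (fun u hu => (isSelfAdjoint_of_mem_isospectral (hρ.mem u hu)).symm)
        (isSelfAdjoint_of_mem_isospectral (hρ.mem t ht)).symm
    exact (hu t ht).eq_deriv _ h1 (hd t ht)
  have hD0 (t) (ht : t ∈ Set.Icc 0 τ) (i) :=
    spectralProj_deriv_spectralProj (hu t ht) ht hρ.mem (hd t ht) i
  have hE (i) : ContinuousOn (fun t => spectralProj σ (ρ t) i) (Set.Icc 0 τ) :=
    (continuous_spectralProj i).comp_continuousOn hρ.contDiffOn.continuousOn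
  have hA : IsHamiltonian τ fun t => generator σ ℏ (ρ t) (D t) := by
    refine ⟨?_, fun t ht => isSelfAdjoint_generator (hρ.mem t ht) ℏ (hDsa t ht)⟩
    unfold generator
    have h1 (i k) : ContinuousOn (fun t => (node σ k - node σ i)⁻¹ •
        (spectralProj σ (ρ t) i * D t * spectralProj σ (ρ t) k)) (Set.Icc 0 τ) :=
      (((hE i).mul hDc).mul (hE k)).const_smul (node σ k - node σ i)⁻¹
    exact (continuousOn_finsetSum _ fun i _ =>
      continuousOn_finsetSum _ fun k _ => h1 i k).const_smul (Complex.I * ℏ : ℂ)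
  have hfield (t) (ht : t ∈ Set.Icc 0 τ) :
      vonNeumannField ℏ (generator σ ℏ (ρ t) (D t)) (ρ t) = D t :=
    vonNeumannField_generator (hρ.mem t ht) hℏ.ne' (hD0 t ht)
  refine ⟨fun t => generator σ ℏ (ρ t) (D t), hA,
    ⟨fun t ht => by rw [hfield t ht]; exact hd t ht, hρ.initial, hρ.final⟩,
    fun t ht => spectralProj_generator_spectralProj (hρ.mem t ht) ℏ (D t), ?_⟩
  rw [curveLength, energyDispersion, ← intervalIntegral.integral_const_mul]
  refine intervalIntegral.integral_congr fun t ht => ?_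
  rw [Set.uIcc_of_le hτ.le] at ht
  have := sqrt_orbitMetric_eq hℏ (hρ.mem t ht) (hA.isSelfAdjoint t ht)
    (spectralProj_generator_spectralProj (hρ.mem t ht) ℏ (D t))
  rwa [hfield t ht] at this

/-- Changing the evolution time by an affine reparametrization does not change the energy
dispersion. -/
theorem exists_rescaled_evolution {τ' : ℝ} (hτ : 0 < τ) (hτ' : 0 < τ') (hA : IsHamiltonian τ A)
    (hρ : IsVonNeumannSolution ℏ τ A ρ₀ ρ₁ ρ) :
    ∃ A' ρ' : ℝ → H →L[ℂ] H, IsHamiltonian τ' A' ∧ IsVonNeumannSolution ℏ τ' A' ρ₀ ρ₁ ρ' ∧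
      energyDispersion ℏ τ' A' ρ' = energyDispersion ℏ τ A ρ := by
  -- Running the evolution `c` times as fast multiplies the Hamiltonian by `c`, and substitution in
  -- the integral cancels this factor.
  set c : ℝ := τ / τ' with hc
  have hc0 : 0 < c := div_pos hτ hτ'
  have hcτ : c * τ' = τ := div_mul_cancel₀ _ hτ'.ne'
  have hmaps : Set.MapsTo (fun t => c * t) (Set.Icc 0 τ') (Set.Icc 0 τ) := fun t ht =>
    ⟨mul_nonneg hc0.le ht.1, hcτ ▸ mul_le_mul_of_nonneg_left ht.2 hc0.le⟩
  refine ⟨fun t => (c : ℂ) • A (c * t), fun t => ρ (c * t), ⟨?_, fun t ht => ?_⟩,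
    ⟨fun t ht => ?_, ?_, ?_⟩, ?_⟩
  · exact (hA.continuousOn.comp (by fun_prop) hmaps).const_smul (c : ℂ)
  · exact IsSelfAdjoint.smul (Complex.conj_ofReal c) (hA.isSelfAdjoint _ (hmaps ht))
  · have h1 : HasDerivWithinAt (fun t : ℝ => c * t) c (Set.Icc 0 τ') t := by
      simpa using ((hasDerivAt_id t).const_mul c).hasDerivWithinAt
    have h2 := (hρ.hasDeriv _ (hmaps ht)).scomp t h1 hmaps
    convert! h2 using 1
    rw [vonNeumannField, vonNeumannField, smul_comp, comp_smul, ← smul_sub, smul_comm,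
      Complex.coe_smul]
  · simp [hρ.initial]
  · simp only [hcτ, hρ.final]
  · unfold energyDispersion
    simp only [uncertainty_smul hc0.le]
    rw [intervalIntegral.integral_const_mul,
      intervalIntegral.mul_integral_comp_mul_left (f := fun t => uncertainty (A t) (ρ t)), hcτ, mul_zero]

end Dispersion

/-! ## Connectedness of the orbit -/

section Connected

theorem finite_spectrum_continuousLinearMap {V : Type*} [NormedAddCommGroup V] [NormedSpace ℂ V]
    [FiniteDimensional ℂ V] (u : V →L[ℂ] V) : (spectrum ℂ u).Finite := by
  have h := AlgEquiv.spectrum_eq (Module.End.toContinuousLinearMap V (𝕜 := ℂ)) (u : V →ₗ[ℂ] V)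
  have e : Module.End.toContinuousLinearMap V (𝕜 := ℂ) (u : V →ₗ[ℂ] V) = u := by ext; rfl
  rw [e] at h
  rw [h]
  exact Module.End.finite_spectrum _

/-- Take `log u` in the functional calculus. The spectrum is finite, so the branch cut does no harm
to continuity, and it lies on the unit circle, so the logarithm is imaginary there. -/
theorem exists_skewAdjoint_exp_eq {V : Type*} [NormedAddCommGroup V] [InnerProductSpace ℂ V]
    [CompleteSpace V] [FiniteDimensional ℂ V] {u : V →L[ℂ] V} (hu : u ∈ unitary (V →L[ℂ] V)) :
    ∃ L ∈ skewAdjoint (V →L[ℂ] V), NormedSpace.exp L = u := by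
  obtain ⟨hn, hsp⟩ := unitary_iff_isStarNormal_and_spectrum_subset_unitary.mp hu
  have hfin := finite_spectrum_continuousLinearMap u
  have hcont (f : ℂ → ℂ) : ContinuousOn f (spectrum ℂ u) := hfin.continuousOn f
  have hnorm (z) (hz : z ∈ spectrum ℂ u) : ‖z‖ = 1 := by
    have := (hsp hz).1
    have h2 : (starRingEnd ℂ) z * z = 1 := this
    rw [← Complex.normSq_eq_conj_mul_self, Complex.normSq_eq_norm_sq] at h2
    have h3 : ‖z‖ ^ 2 = 1 := by exact_mod_cast h2
    nlinarith [norm_nonneg z]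
  refine ⟨cfc Complex.log u, ?_, ?_⟩
  · rw [skewAdjoint.mem_iff, ← cfc_star, ← cfc_neg]
    refine cfc_congr fun z hz => ?_
    apply Complex.ext
    · simp [Complex.log_re, hnorm z hz]
    · simp
  · have hs : IsStarNormal (cfc Complex.log u) := cfc_predicate _ _
    rw [← CFC.complex_exp_eq_normedSpace_exp,
      ← cfc_comp Complex.exp Complex.log u hn (Complex.continuous_exp.continuousOn) (hcont _)]
    conv_rhs => rw [← cfc_id ℂ u]
    refine cfc_congr fun z hz => ?_
    refine Complex.exp_log fun h0 => ?_
    have := hnorm z hz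
    rw [h0, norm_zero] at this
    exact zero_ne_one this

variable {H : Type*} [NormedAddCommGroup H] [InnerProductSpace ℂ H] [CompleteSpace H]
  {σ : DensitySpectrum}

/-- The diagonal operator on the purifying space with entry `f j` on the `j`-th block. -/
def blockScale (σ : DensitySpectrum) (f : Fin σ.l → ℝ) : AuxSpace σ →L[ℂ] AuxSpace σ :=
  ∑ j, (f j : ℂ) • blockProj σ j

theorem blockScale_ket (f : Fin σ.l → ℝ) (i : Σ j : Fin σ.l, Fin (σ.m j)) :
    blockScale σ f (ket σ i) = (f i.1 : ℂ) • ket σ i := by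
  simp [blockScale, blockProj_ket]

/-- The isometry in the polar decomposition of a purification. -/
def polarIsometry (ψ : AuxSpace σ →L[ℂ] H) : AuxSpace σ →L[ℂ] H :=
  ψ ∘L blockScale σ fun j => (√(σ.p j))⁻¹

omit [CompleteSpace H] in
theorem polarIsometry_ket (ψ : AuxSpace σ →L[ℂ] H) (i : Σ j : Fin σ.l, Fin (σ.m j)) :
    polarIsometry ψ (ket σ i) = (((√(σ.p i.1))⁻¹ : ℝ) : ℂ) • ψ (ket σ i) := by
  rw [polarIsometry, comp_apply, blockScale_ket, map_smul]

omit [CompleteSpace H] in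
theorem polarIsometry_comp (ψ : AuxSpace σ →L[ℂ] H) :
    polarIsometry ψ ∘L (blockScale σ fun j => √(σ.p j)) = ψ := by
  refine ext_on_ket fun i => ?_
  have h : (√(σ.p i.1)) ≠ 0 := (Real.sqrt_pos.mpr (σ.p_pos i.1)).ne'
  rw [comp_apply, blockScale_ket, map_smul, polarIsometry_ket, smul_smul, ← Complex.ofReal_mul,
    mul_inv_cancel₀ h, Complex.ofReal_one, one_smul]

theorem adjoint_polarIsometry_comp {ψ : AuxSpace σ →L[ℂ] H} (hψ : ψ ∈ purifications σ H) :
    adjoint (polarIsometry ψ) ∘L polarIsometry ψ = 1 := by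
  refine ext_on_ket fun j => ?_
  ext i
  have h : (√(σ.p j.1)) ≠ 0 := (Real.sqrt_pos.mpr (σ.p_pos j.1)).ne'
  have h2 := inner_ket (σ := σ) i j
  rw [ket, EuclideanSpace.inner_single_left, map_one, one_mul] at h2
  rw [comp_apply, adjoint_apply_coord, polarIsometry_ket, polarIsometry_ket, inner_smul_left,
    inner_smul_right, inner_purification hψ, one_apply_eq_self, h2, Complex.conj_ofReal]
  split_ifs with hij
  · subst hij
    norm_cast
    field_simp
    rw [Real.sq_sqrt (σ.p_pos i.1).le]
  · simp

theorem norm_polarIsometry {ψ : AuxSpace σ →L[ℂ] H} (hψ : ψ ∈ purifications σ H)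
    (x : AuxSpace σ) : ‖polarIsometry ψ x‖ = ‖x‖ := by
  have h : inner ℂ (polarIsometry ψ x) (polarIsometry ψ x) = inner ℂ x x := by
    rw [← adjoint_inner_right, ← comp_apply, adjoint_polarIsometry_comp hψ, one_apply_eq_self]
  rw [@norm_eq_sqrt_re_inner ℂ, h, ← @norm_eq_sqrt_re_inner ℂ]

/-- Conjugation with the unitary group through `u` joins the two states. -/
theorem exists_isCurveIn_of_unitary {V : Type*} [NormedAddCommGroup V] [InnerProductSpace ℂ V]
    [CompleteSpace V] [FiniteDimensional ℂ V] (ι : V →ₗᵢ[ℂ] H) {u : V →L[ℂ] V}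
    (hu : u ∈ unitary (V →L[ℂ] V)) (j : AuxSpace σ →L[ℂ] V) {ψ₀ ψ₁ : AuxSpace σ →L[ℂ] H}
    (hψ₀ : ψ₀ ∈ purifications σ H) (h₀ : ∀ x, ι (j x) = ψ₀ x) (h₁ : ∀ x, ι (u (j x)) = ψ₁ x) :
    ∃ ρ : ℝ → H →L[ℂ] H, IsCurveIn σ (bundleProj ψ₀) (bundleProj ψ₁) 1 ρ := by
  obtain ⟨L, hL, hLu⟩ := exists_skewAdjoint_exp_eq hu
  let T : V →L[ℂ] H := ι.toContinuousLinearMap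
  let U : ℝ → V →L[ℂ] V := fun t => NormedSpace.exp (t • L)
  let ψ : ℝ → AuxSpace σ →L[ℂ] H := fun t => T ∘L (U t ∘L j)
  let ψ' : ℝ → AuxSpace σ →L[ℂ] H := fun t => T ∘L ((U t * L) ∘L j)
  have hU0 : U 0 = 1 := by simp only [U, zero_smul, NormedSpace.exp_zero]
  have hU1 : U 1 = u := by simp only [U, one_smul, hLu]
  have hUd (t) : HasDerivAt U (U t * L) t := hasDerivAt_exp_smul_const L t
  have hUc : Continuous U := continuous_iff_continuousAt.mpr fun t => (hUd t).continuousAt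
  have hψd (t) : HasDerivWithinAt ψ (ψ' t) (Set.Icc 0 1) t := by
    have h1 := hasDerivWithinAt_comp (hUd t).hasDerivWithinAt
      (hasDerivWithinAt_const t (Set.Icc 0 1) j)
    have h2 := hasDerivWithinAt_comp (hasDerivWithinAt_const t (Set.Icc 0 1) T) h1
    rw [comp_zero, zero_add, zero_comp, add_zero] at h2
    exact h2
  have hψc : Continuous ψ := continuous_const.clm_comp (hUc.clm_comp continuous_const)
  have hψ'c : Continuous ψ' :=
    continuous_const.clm_comp ((hUc.mul continuous_const).clm_comp continuous_const)
  have e0 : ψ 0 = ψ₀ := by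
    ext x
    change ι (U 0 (j x)) = _
    rw [hU0, one_apply_eq_self, h₀]
  have e1 : ψ 1 = ψ₁ := by
    ext x
    change ι (U 1 (j x)) = _
    rw [hU1, h₁]
  have hmem (t) : ψ t ∈ purifications σ H := by
    have hUt : U t ∈ unitary (V →L[ℂ] V) :=
      let +nondep : NormedAlgebra ℚ (V →L[ℂ] V) := .restrictScalars ℚ ℂ _
      NormedSpace.exp_mem_unitary_of_mem_skewAdjoint (skewAdjoint.smul_mem t hL)
    refine mem_purifications_of_inner fun i k => ?_
    change inner ℂ (ι (U t _)) (ι (U t _)) = _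
    rw [ι.inner_map_map, ← adjoint_inner_right, ← mul_apply_eq_comp,
      show adjoint (U t) * U t = 1 from (Unitary.mem_iff.mp hUt).1, one_apply_eq_self,
      ← ι.inner_map_map]
    exact (congrArg₂ (inner ℂ) (h₀ _) (h₀ _)).trans (inner_purification hψ₀ i k)
  have hadj {f : ℝ → AuxSpace σ →L[ℂ] H} (hf : Continuous f) :
      Continuous fun t => adjoint (f t) := (LinearIsometryEquiv.continuous _).comp hf
  refine ⟨fun t => bundleProj (ψ t), ⟨?_, fun t _ => bundleProj_mem_isospectral (hmem t), ?_, ?_⟩⟩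
  · refine contDiffOn_one_of_hasDerivWithinAt one_pos
      (fun t _ => hasDerivWithinAt_bundleProj (hψd t)) (Continuous.continuousOn ?_)
    exact (hψ'c.clm_comp (hadj hψc)).add (hψc.clm_comp (hadj hψ'c))
  · simp only [e0]
  · simp only [e1]

/-- Everything takes place in the sum `V` of the ranges of the two polar isometries. The isometry
between these ranges extends to `V`, and it is unitary there because `V` is finite dimensional. -/
theorem exists_isCurveIn {ρ₀ ρ₁ : H →L[ℂ] H} (hρ₀ : ρ₀ ∈ isospectral σ H)
    (hρ₁ : ρ₁ ∈ isospectral σ H) : ∃ ρ : ℝ → H →L[ℂ] H, IsCurveIn σ ρ₀ ρ₁ 1 ρ := by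
  obtain ⟨ψ₀, hψ₀, rfl⟩ := exists_purification hρ₀
  obtain ⟨ψ₁, hψ₁, rfl⟩ := exists_purification hρ₁
  set j₀ := polarIsometry ψ₀ with hj₀
  set j₁ := polarIsometry ψ₁ with hj₁
  let V : Submodule ℂ H := LinearMap.range (j₀ : AuxSpace σ →ₗ[ℂ] H) ⊔
    LinearMap.range (j₁ : AuxSpace σ →ₗ[ℂ] H)
  have hfd : FiniteDimensional ℂ V := inferInstance
  have hcs : CompleteSpace V := FiniteDimensional.complete ℂ V
  have hm₀ (x) : j₀ x ∈ V := Submodule.mem_sup_left ⟨x, rfl⟩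
  have hm₁ (x) : j₁ x ∈ V := Submodule.mem_sup_right ⟨x, rfl⟩
  let i₀ : AuxSpace σ →ₗᵢ[ℂ] V :=
    ⟨(j₀ : AuxSpace σ →ₗ[ℂ] H).codRestrict V hm₀, norm_polarIsometry hψ₀⟩
  let i₁ : AuxSpace σ →ₗᵢ[ℂ] V :=
    ⟨(j₁ : AuxSpace σ →ₗ[ℂ] H).codRestrict V hm₁, norm_polarIsometry hψ₁⟩
  let U : V →ₗᵢ[ℂ] V := (i₁.comp i₀.equivRange.symm.toLinearIsometry).extend
  have hU (x) : U (i₀ x) = i₁ x := by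
    have := (i₁.comp i₀.equivRange.symm.toLinearIsometry).extend_apply (i₀.equivRange x)
    simpa using this
  let e : V ≃ₗᵢ[ℂ] V := U.toLinearIsometryEquiv rfl
  refine exists_isCurveIn_of_unitary V.subtypeₗᵢ (Unitary.linearIsometryEquiv.symm e).2
    (i₀.toContinuousLinearMap ∘L blockScale σ fun j => √(σ.p j)) hψ₀ (fun x => ?_) fun x => ?_
  · conv_rhs => rw [← polarIsometry_comp ψ₀]
    rfl
  · conv_rhs => rw [← polarIsometry_comp ψ₁]
    exact congrArg Subtype.val (hU (blockScale σ (fun j => √(σ.p j)) x))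

end Connected

/-! ## Comparison with the Bures length -/

section Bures

/-- The angle swept by a curve on the unit sphere is at most its length: `f` is the cosine of the
angle to the initial point, and `v` the speed. -/
theorem arccos_le_integral_of_abs_deriv_le {f f' v : ℝ → ℝ} {τ : ℝ} (hτ : 0 ≤ τ)
    (hf : ∀ t ∈ Set.Icc 0 τ, HasDerivWithinAt f (f' t) (Set.Icc 0 τ) t)
    (hf' : ContinuousOn f' (Set.Icc 0 τ)) (hv : ContinuousOn v (Set.Icc 0 τ))
    (hv0 : ∀ t ∈ Set.Icc 0 τ, 0 ≤ v t)
    (hf1 : ∀ t ∈ Set.Icc 0 τ, |f t| ≤ 1) (hle : ∀ t ∈ Set.Icc 0 τ, |f' t| ≤ v t * √(1 - f t ^ 2))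
    (h0 : f 0 = 1) : Real.arccos (f τ) ≤ ∫ t in (0 : ℝ)..τ, v t := by
  have hfc : ContinuousOn f (Set.Icc 0 τ) := fun t ht => (hf t ht).continuousWithinAt
  have hlt (c : ℝ) (hc : c ∈ Set.Ioo (0 : ℝ) 1) (t) (ht : t ∈ Set.Icc 0 τ) : |c * f t| < 1 := by
    rw [abs_mul, abs_of_pos hc.1]
    calc c * |f t| ≤ c * 1 := mul_le_mul_of_nonneg_left (hf1 t ht) hc.1.le
      _ < 1 := by rw [mul_one]; exact hc.2
  have hpos (c : ℝ) (hc : c ∈ Set.Ioo (0 : ℝ) 1) (t) (ht : t ∈ Set.Icc 0 τ) :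
      0 < 1 - (c * f t) ^ 2 := by
    have := (sq_lt_one_iff_abs_lt_one _).mpr (hlt c hc t ht)
    linarith
  -- `arcsin` is not differentiable at `±1`, and `f` starts at `1`. The factor `c < 1` keeps the
  -- argument inside the open interval and only weakens the speed bound; at the end `c → 1`.
  have key (c : ℝ) (hc : c ∈ Set.Ioo (0 : ℝ) 1) :
      Real.arcsin (c * f 0) - Real.arcsin (c * f τ) ≤ ∫ t in (0 : ℝ)..τ, v t := by
    have hd (t) (ht : t ∈ Set.Icc 0 τ) : HasDerivWithinAt (fun t => Real.arcsin (c * f t))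
        (1 / √(1 - (c * f t) ^ 2) * (c * f' t)) (Set.Icc 0 τ) t := by
      have h := abs_lt.mp (hlt c hc t ht)
      exact (Real.hasDerivAt_arcsin h.1.ne' h.2.ne).comp_hasDerivWithinAt t ((hf t ht).const_mul c)
    have hdc : ContinuousOn (fun t => 1 / √(1 - (c * f t) ^ 2) * (c * f' t)) (Set.Icc 0 τ) := by
      refine (ContinuousOn.div continuousOn_const ?_ fun t ht =>
        (Real.sqrt_pos.mpr (hpos c hc t ht)).ne').mul (continuousOn_const.mul hf')
      exact (continuousOn_const.sub ((continuousOn_const.mul hfc).pow 2)).sqrt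
    have hftc : ∫ t in (0 : ℝ)..τ, 1 / √(1 - (c * f t) ^ 2) * (c * f' t)
        = Real.arcsin (c * f τ) - Real.arcsin (c * f 0) := by
      refine intervalIntegral.integral_eq_sub_of_hasDerivAt_of_le hτ
        (fun t ht => (hd t ht).continuousWithinAt)
        (fun t ht => (hd t (Set.Ioo_subset_Icc_self ht)).hasDerivAt (Icc_mem_nhds ht.1 ht.2)) ?_
      exact (hdc.mono (by rw [Set.uIcc_of_le hτ])).intervalIntegrable
    rw [← neg_sub, ← hftc, ← intervalIntegral.integral_neg]
    refine intervalIntegral.integral_mono_on hτ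
      (hdc.neg.mono (by rw [Set.uIcc_of_le hτ])).intervalIntegrable
      (hv.mono (by rw [Set.uIcc_of_le hτ])).intervalIntegrable fun t ht => ?_
    refine (neg_le_abs _).trans ?_
    have hs := Real.sqrt_pos.mpr (hpos c hc t ht)
    rw [abs_mul, abs_of_pos (one_div_pos.mpr hs), abs_mul, abs_of_pos hc.1, one_div,
      inv_mul_le_iff₀ hs]
    calc c * |f' t| ≤ 1 * |f' t| := mul_le_mul_of_nonneg_right hc.2.le (abs_nonneg _)
      _ ≤ v t * √(1 - f t ^ 2) := by rw [one_mul]; exact hle t ht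
      _ ≤ v t * √(1 - (c * f t) ^ 2) := by
          refine mul_le_mul_of_nonneg_left (Real.sqrt_le_sqrt ?_) (hv0 t ht)
          have : c ^ 2 ≤ 1 := pow_le_one₀ hc.1.le hc.2.le
          rw [mul_pow]
          nlinarith [sq_nonneg (f t)]
      _ = _ := mul_comm _ _
  have hcont : Continuous fun c : ℝ => Real.arcsin (c * f 0) - Real.arcsin (c * f τ) := by
    have := Real.continuous_arcsin
    fun_prop
  have hlim : Filter.Tendsto (fun c : ℝ => Real.arcsin (c * f 0) - Real.arcsin (c * f τ))
      (nhdsWithin 1 (Set.Ioo 0 1)) (nhds (Real.arcsin (1 * f 0) - Real.arcsin (1 * f τ))) :=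
    hcont.continuousAt.continuousWithinAt
  have hne : (nhdsWithin (1 : ℝ) (Set.Ioo 0 1)).NeBot := by
    rw [← mem_closure_iff_nhdsWithin_neBot, closure_Ioo zero_ne_one]
    exact ⟨zero_le_one, le_rfl⟩
  have := le_of_tendsto hlim (eventually_nhdsWithin_of_forall key)
  rwa [h0, one_mul, one_mul, Real.arcsin_one] at this

variable {H : Type*} [NormedAddCommGroup H] [InnerProductSpace ℂ H] [CompleteSpace H]
  {σ : DensitySpectrum}

theorem abs_hsMetric_le (X Y : AuxSpace σ →L[ℂ] H) :
    |hsMetric X Y| ≤ √(hsMetric X X) * √(hsMetric Y Y) := by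
  rw [hsMetric_self_eq_sum, hsMetric_self_eq_sum, hsMetric_eq_sum]
  calc |∑ i, (inner ℂ (X (ket σ i)) (Y (ket σ i))).re|
      ≤ ∑ i, |(inner ℂ (X (ket σ i)) (Y (ket σ i))).re| := Finset.abs_sum_le_sum_abs _ _
    _ ≤ ∑ i, ‖X (ket σ i)‖ * ‖Y (ket σ i)‖ := Finset.sum_le_sum fun i _ =>
        (Complex.abs_re_le_norm _).trans (norm_inner_le_norm _ _)
    _ ≤ _ := Real.sum_mul_le_sqrt_mul_sqrt _ _ _

/-- The great circle distance of purifications is at most the length of a curve that joins them. -/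
theorem arccos_hsMetric_le {ψ ψ' : ℝ → AuxSpace σ →L[ℂ] H} {τ : ℝ} (hτ : 0 ≤ τ)
    (hψ : ∀ t ∈ Set.Icc 0 τ, ψ t ∈ purifications σ H)
    (hd : ∀ t ∈ Set.Icc 0 τ, HasDerivWithinAt ψ (ψ' t) (Set.Icc 0 τ) t)
    (hψ' : ContinuousOn ψ' (Set.Icc 0 τ)) (htan : ∀ t ∈ Set.Icc 0 τ, ψ' t ∈ tangentAt (ψ t)) :
    Real.arccos (hsMetric (ψ τ) (ψ 0)) ≤ ∫ t in (0 : ℝ)..τ, √(hsMetric (ψ' t) (ψ' t)) := by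
  have h1 (t) (ht : t ∈ Set.Icc 0 τ) : hsMetric (ψ t) (ψ t) = 1 := hsMetric_purification (hψ t ht)
  have hm0 : (0 : ℝ) ∈ Set.Icc 0 τ := Set.left_mem_Icc.mpr hτ
  have hk (i) : ContinuousOn (fun t => ψ' t (ket σ i)) (Set.Icc 0 τ) :=
    hψ'.clm_apply continuousOn_const
  refine arccos_le_integral_of_abs_deriv_le (f := fun t => hsMetric (ψ t) (ψ 0))
    (f' := fun t => hsMetric (ψ' t) (ψ 0)) hτ ?_ ?_ ?_ (fun t _ => Real.sqrt_nonneg _) ?_ ?_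
    (h1 0 hm0)
  · intro t ht
    simp only [hsMetric_eq_sum]
    refine HasDerivWithinAt.fun_sum fun i _ => ?_
    have hev : HasDerivWithinAt (fun u => ψ u (ket σ i)) (ψ' t (ket σ i)) (Set.Icc 0 τ) t :=
      ((apply ℂ H (ket σ i)).restrictScalars ℝ).hasFDerivAt.comp_hasDerivWithinAt t (hd t ht)
    have h2 := hev.inner ℂ (hasDerivWithinAt_const t (Set.Icc 0 τ) (ψ 0 (ket σ i)))
    have h3 := Complex.reCLM.hasFDerivAt.comp_hasDerivWithinAt t h2
    simp only [inner_zero_right, zero_add] at h3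
    exact h3
  · simp only [hsMetric_eq_sum]
    exact continuousOn_finsetSum _ fun i _ => Complex.continuous_re.comp_continuousOn
      (ContinuousOn.inner (𝕜 := ℂ) (hk i) continuousOn_const)
  · simp only [hsMetric_self_eq_sum]
    exact (continuousOn_finsetSum _ fun i _ => (hk i).norm.pow 2).sqrt
  · intro t ht
    refine (abs_hsMetric_le _ _).trans ?_
    rw [h1 t ht, h1 0 hm0]
    simp
  · intro t ht
    have htan' : hsMetric (ψ' t) (ψ t) = 0 := by
      have h : adjoint (ψ' t) ∘L ψ t + adjoint (ψ t) ∘L ψ' t = 0 := htan t ht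
      rw [hsMetric, h]
      simp
    change |hsMetric (ψ' t) (ψ 0)| ≤ _ * √(1 - hsMetric (ψ t) (ψ 0) ^ 2)
    set c := hsMetric (ψ t) (ψ 0) with hc
    have hsymm (X Y : AuxSpace σ →L[ℂ] H) : hsMetric X Y = hsMetric Y X := by
      unfold hsMetric; rw [add_comm]
    have hsub (X Y Z : AuxSpace σ →L[ℂ] H) :
        hsMetric X (Y - (c : ℂ) • Z) = hsMetric X Y - c * hsMetric X Z := by
      simp only [hsMetric_eq_sum, Finset.mul_sum, ← Finset.sum_sub_distrib]
      refine Finset.sum_congr rfl fun i _ => ?_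
      simp [inner_sub_right, inner_smul_right]
    -- The velocity is orthogonal to `ψ t`, so only the component of `ψ 0` orthogonal to `ψ t`
    -- counts. It has squared norm `1 - c²`, and Cauchy-Schwarz gives the bound.
    have e1 : hsMetric (ψ' t) (ψ 0) = hsMetric (ψ' t) (ψ 0 - (c : ℂ) • ψ t) := by
      rw [hsub, htan', mul_zero, sub_zero]
    have e2 : hsMetric (ψ 0 - (c : ℂ) • ψ t) (ψ 0 - (c : ℂ) • ψ t) = 1 - c ^ 2 := by
      rw [hsub, hsymm _ (ψ 0), hsub, hsymm (ψ 0 - _) (ψ t), hsub, h1 0 hm0, h1 t ht,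
        hsymm (ψ 0) (ψ t), ← hc]
      ring
    rw [e1, ← e2]
    exact abs_hsMetric_le _ _

end Bures

/-! ### Fidelity as a bound for the overlap of purifications -/

section Fidelity

variable {H : Type*} [NormedAddCommGroup H] [InnerProductSpace ℂ H] [CompleteSpace H]
  {σ : DensitySpectrum}

theorem blockScale_comp (f g : Fin σ.l → ℝ) :
    blockScale σ f ∘L blockScale σ g = blockScale σ fun j => f j * g j := by
  refine ext_ket fun i => ?_
  rw [comp_apply, blockScale_ket, map_smul, blockScale_ket, blockScale_ket, smul_smul,
    Complex.ofReal_mul, mul_comm]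

theorem adjoint_blockScale (f : Fin σ.l → ℝ) : adjoint (blockScale σ f) = blockScale σ f := by
  refine ext_ket fun j => ?_
  ext i
  have h2 := inner_ket (σ := σ) i j
  rw [ket, EuclideanSpace.inner_single_left, map_one, one_mul] at h2
  rw [adjoint_apply_coord, blockScale_ket, inner_smul_left, inner_ket, blockScale_ket,
    PiLp.smul_apply, h2, Complex.conj_ofReal, smul_eq_mul]
  split_ifs with h
  · rw [h]
  · rw [mul_zero, mul_zero]

/-- The square root of a state is determined by the polar decomposition of a purification. -/
theorem sqrt_bundleProj {ψ : AuxSpace σ →L[ℂ] H} (hψ : ψ ∈ purifications σ H) :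
    CFC.sqrt (bundleProj ψ) =
      polarIsometry ψ ∘L (blockScale σ fun j => √(σ.p j)) ∘L adjoint (polarIsometry ψ) := by
  set W := polarIsometry ψ with hW
  set D := blockScale σ fun j => √(σ.p j) with hD
  have hWD : W ∘L D = ψ := polarIsometry_comp ψ
  have hDD : adjoint D = D := adjoint_blockScale _
  refine CFC.sqrt_unique ?_ ?_
  · calc (W ∘L D ∘L adjoint W) ∘L (W ∘L D ∘L adjoint W)
        = (W ∘L D) ∘L (adjoint W ∘L W) ∘L (D ∘L adjoint W) := by simp only [comp_assoc]
      _ = (W ∘L D) ∘L adjoint (W ∘L D) := by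
          rw [adjoint_polarIsometry_comp hψ, adjoint_comp, hDD]; rfl
      _ = bundleProj ψ := by rw [hWD, bundleProj]
  · have h : D = (blockScale σ fun j => √(√(σ.p j))) ∘L blockScale σ fun j => √(√(σ.p j)) := by
      rw [blockScale_comp, hD]
      congr 1
      funext j
      rw [Real.mul_self_sqrt (Real.sqrt_nonneg _)]
    have h2 : W ∘L D ∘L adjoint W = bundleProj (W ∘L blockScale σ fun j => √(√(σ.p j))) := by
      rw [bundleProj, adjoint_comp, adjoint_blockScale, h]
      simp only [comp_assoc]
    rw [h2, nonneg_iff_isPositive]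
    exact bundleProj_isPositive _

/-- The trace norm dominates: `Re Tr (W†N) ≤ Tr √(NN†)` for contractions `W`. -/
theorem hsMetric_le_opTrace_sqrt (W N : AuxSpace σ →L[ℂ] H) (hW : ∀ x, ‖W x‖ ≤ ‖x‖) :
    hsMetric W N ≤ (opTrace (CFC.sqrt (bundleProj N))).re := by
  have hQ : 0 ≤ bundleProj N := (nonneg_iff_isPositive _).mpr (bundleProj_isPositive N)
  set T := CFC.sqrt (bundleProj N) with hTdef
  have hTT : T ∘L T = bundleProj N := CFC.sqrt_mul_sqrt_self _ hQ
  have hTpos : T.IsPositive := (nonneg_iff_isPositive _).mp (CFC.sqrt_nonneg _)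
  have hTadj : adjoint T = T := hTpos.isSelfAdjoint
  have hTsymm : (T : H →ₗ[ℂ] H).IsSymmetric := hTpos.isSelfAdjoint.isSymmetric
  have hnorm (x : H) : ‖T x‖ = ‖adjoint N x‖ := by
    have h1 : inner ℂ (T x) (T x) = inner ℂ (adjoint N x) (adjoint N x) := by
      rw [← adjoint_inner_right, hTadj, ← comp_apply, hTT, adjoint_inner_left]
      rfl
    rw [@norm_eq_sqrt_re_inner ℂ, h1, ← @norm_eq_sqrt_re_inner ℂ]
  -- `T` kills the orthogonal complement of the range of `N`, so it maps into this finite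
  -- dimensional space and is diagonalized there; its trace is the sum of the eigenvalues `t n`.
  let V := LinearMap.range (N : AuxSpace σ →ₗ[ℂ] H)
  have hTV (x) : T x ∈ V := by
    rw [← Submodule.orthogonal_orthogonal V, Submodule.mem_orthogonal]
    intro y hy
    have hNy : adjoint N y = 0 := by
      ext i
      rw [adjoint_apply_coord]
      exact (Submodule.mem_orthogonal V y).mp hy _ ⟨ket σ i, rfl⟩
    have hTy : T y = 0 := by rw [← norm_eq_zero, hnorm, hNy, norm_zero]
    rw [← adjoint_inner_left, hTadj, hTy, inner_zero_left]
  have hS := hTsymm.restrict_invariant (V := V) fun v _ => hTV v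
  let u := hS.eigenvectorBasis rfl
  let t := hS.eigenvalues rfl
  have hu1 (n) : ‖(u n : H)‖ = 1 := u.orthonormal.1 n
  have hTu (n) : T (u n : H) = (t n : ℂ) • (u n : H) :=
    congrArg Subtype.val (hS.apply_eigenvectorBasis rfl n)
  have ht0 (n) : 0 ≤ t n := by
    have h2 := hTpos.inner_nonneg_right (u n : H)
    rw [hTu, inner_smul_right, inner_self_eq_norm_sq_to_K, hu1] at h2
    simpa using h2
  have hexp (v : H) (hv : v ∈ V) : v = ∑ n, inner ℂ (u n : H) v • (u n : H) := by
    have h1 := u.sum_repr' ⟨v, hv⟩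
    have h2 := congrArg (Subtype.val) h1
    simpa using h2.symm
  have htr : opTrace T = ∑ n, (t n : ℂ) := by
    have h1 (v) : T v = ∑ n, inner ℂ (u n : H) v • T (u n : H) := by
      conv_lhs => rw [hexp (T v) (hTV v)]
      refine Finset.sum_congr rfl fun n _ => ?_
      rw [← adjoint_inner_left, hTadj, hTu, inner_smul_left, Complex.conj_ofReal, smul_smul,
        mul_comm]
    rw [opTrace, (hasSum_diagCoeff_of_eq_sum h1).tsum_eq]
    refine Finset.sum_congr rfl fun n _ => ?_
    rw [hTu, inner_smul_right, inner_self_eq_norm_sq_to_K, hu1]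
    simp
  have hWn : ‖adjoint W‖ ≤ 1 := by
    rw [LinearIsometryEquiv.norm_map]
    exact opNorm_le_bound _ zero_le_one fun x => by rw [one_mul]; exact hW x
  -- Rewriting the overlap in the eigenbasis `u` of `T` allows a bound term by term, since `‖N†uₙ‖ =
  -- ‖T uₙ‖ = tₙ` and `‖W†uₙ‖ ≤ 1`.
  have hsum : ∑ i, inner ℂ (W (ket σ i)) (N (ket σ i))
      = ∑ n, inner ℂ (adjoint N (u n : H)) (adjoint W (u n : H)) := by
    have h1 (i) : inner ℂ (W (ket σ i)) (N (ket σ i))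
        = ∑ n, inner ℂ (u n : H) (N (ket σ i)) * inner ℂ (W (ket σ i)) (u n : H) := by
      conv_lhs => rw [hexp (N (ket σ i)) ⟨_, rfl⟩]
      rw [inner_sum]
      exact Finset.sum_congr rfl fun n _ => inner_smul_right _ _ _
    simp only [h1]
    rw [Finset.sum_comm]
    refine Finset.sum_congr rfl fun n _ => ?_
    rw [PiLp.inner_apply]
    refine Finset.sum_congr rfl fun i _ => ?_
    rw [adjoint_apply_coord, adjoint_apply_coord, RCLike.inner_apply, inner_conj_symm, mul_comm]
  rw [hsMetric_eq_sum, ← Complex.re_sum, hsum, htr, Complex.re_sum, Complex.re_sum]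
  refine Finset.sum_le_sum fun n _ => ?_
  rw [Complex.ofReal_re]
  calc (inner ℂ (adjoint N (u n : H)) (adjoint W (u n : H))).re
      ≤ ‖adjoint N (u n : H)‖ * ‖adjoint W (u n : H)‖ :=
        (Complex.re_le_norm _).trans (norm_inner_le_norm _ _)
    _ ≤ t n * 1 := by
        gcongr
        · exact ht0 n
        · rw [← hnorm, hTu, norm_smul, hu1, mul_one, Complex.norm_real, Real.norm_of_nonneg (ht0 n)]
        · exact (adjoint W).le_of_opNorm_le_of_le hWn (hu1 n).le |>.trans (by norm_num)
    _ = t n := mul_one _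

/-- With the polar decomposition `ψ₀ = √ρ₀ W`, the overlap is that of the isometry `W` with `N = √ρ₀
ψ₁`, and `NN† = √ρ₀ ρ₁ √ρ₀`. The trace norm bound finishes the proof. -/
theorem hsMetric_le_sqrt_fidelity {ψ₀ ψ₁ : AuxSpace σ →L[ℂ] H} (hψ₀ : ψ₀ ∈ purifications σ H) :
    hsMetric ψ₀ ψ₁ ≤ √(fidelity (bundleProj ψ₀) (bundleProj ψ₁)) := by
  have hS := sqrt_bundleProj hψ₀
  set W := polarIsometry ψ₀ with hW
  set S := CFC.sqrt (bundleProj ψ₀) with hSdef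
  have hSadj : adjoint S = S :=
    ((nonneg_iff_isPositive _).mp (CFC.sqrt_nonneg (bundleProj ψ₀))).isSelfAdjoint
  have hSW : S ∘L W = ψ₀ := by
    rw [hS]
    calc (W ∘L (blockScale σ fun j => √(σ.p j)) ∘L adjoint W) ∘L W
        = W ∘L (blockScale σ fun j => √(σ.p j)) ∘L (adjoint W ∘L W) := by simp only [comp_assoc]
      _ = W ∘L (blockScale σ fun j => √(σ.p j)) := by
          rw [adjoint_polarIsometry_comp hψ₀]; rfl
      _ = ψ₀ := polarIsometry_comp ψ₀
  have h1 : hsMetric ψ₀ ψ₁ = hsMetric W (S ∘L ψ₁) := by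
    rw [hsMetric_eq_sum, hsMetric_eq_sum]
    refine Finset.sum_congr rfl fun i _ => ?_
    conv_lhs => rw [← hSW]
    rw [comp_apply, comp_apply, ← adjoint_inner_right, hSadj]
  have h2 : S ∘L bundleProj ψ₁ ∘L S = bundleProj (S ∘L ψ₁) := by
    rw [bundleProj, bundleProj, adjoint_comp, hSadj]
    simp only [comp_assoc]
  rw [h1, fidelity, ← hSdef, h2, Real.sqrt_sq_eq_abs]
  exact (hsMetric_le_opTrace_sqrt W _ fun x => (norm_polarIsometry hψ₀ x).le).trans (le_abs_self _)

/-- Driving the curve by an off-diagonal Hamiltonian, with `1` in place of `ħ`, makes its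
Schrödinger lift horizontal, so the lift is as long as the curve. Then the great circle bound and
the overlap bound combine, as `arccos` is decreasing. -/
theorem buresLength_le_curveLength {τ : ℝ} {ρ₀ ρ₁ : H →L[ℂ] H} {ρ : ℝ → H →L[ℂ] H} (hτ : 0 < τ)
    (hρ : IsCurveIn σ ρ₀ ρ₁ τ ρ) : buresLength ρ₀ ρ₁ ≤ curveLength σ τ ρ := by
  obtain ⟨A, hA, hsol, hA0, -⟩ := exists_hamiltonian_of_isCurveIn one_pos hτ hρ
  have h0 : ρ₀ ∈ isospectral σ H := hρ.initial ▸ hρ.mem 0 (Set.left_mem_Icc.mpr hτ.le)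
  obtain ⟨ψ₀, hψ₀, hψρ⟩ := exists_purification h0
  obtain ⟨ψ, hinit, hψ⟩ := exists_schrodinger_lift hτ.le hA hsol hψ₀ hψρ
  have hc : ContinuousOn ψ (Set.Icc 0 τ) := fun t ht => (hψ t ht).2.2.continuousWithinAt
  have hle := arccos_hsMetric_le hτ.le (fun t ht => (hψ t ht).1) (fun t ht => (hψ t ht).2.2)
    ((hA.continuousOn.clm_comp hc).const_smul (1 / (Complex.I * (1 : ℝ)) : ℂ))
    fun t ht => schrodingerField_mem_tangentAt 1 (hA.isSelfAdjoint t ht) (ψ t)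
  have hlen : curveLength σ τ ρ = ∫ t in (0 : ℝ)..τ,
      √(hsMetric (schrodingerField 1 (A t) (ψ t)) (schrodingerField 1 (A t) (ψ t))) := by
    refine intervalIntegral.integral_congr fun t ht => ?_
    rw [Set.uIcc_of_le hτ.le] at ht
    rw [(hsol.hasDeriv t ht).derivWithin (uniqueDiffOn_Icc hτ t ht), hsMetric_schrodingerField,
      ← (hψ t ht).2.1, orbitMetric_vonNeumannField 1 (hψ t ht).1 (hA.isSelfAdjoint t ht)]
    rw [(hψ t ht).2.1]
    exact hA0 t ht
  rw [hlen]
  refine le_trans ?_ hle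
  have hτm : τ ∈ Set.Icc 0 τ := Set.right_mem_Icc.mpr hτ.le
  have e0 : bundleProj (ψ 0) = ρ₀ := by rw [hinit, hψρ]
  have e1 : bundleProj (ψ τ) = ρ₁ := by rw [(hψ τ hτm).2.1, hsol.final]
  have hsymm : hsMetric (ψ τ) (ψ 0) = hsMetric (ψ 0) (ψ τ) := by
    unfold hsMetric; rw [add_comm]
  rw [buresLength, ← e0, ← e1, hsymm]
  exact Real.arccos_le_arccos (hsMetric_le_sqrt_fidelity (hψ 0 (Set.left_mem_Icc.mpr hτ.le)).1)

end Fidelity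

/-! ### Geodesic distance, energy dispersion and Bures length -/

section Distance

variable {H : Type*} [NormedAddCommGroup H] [InnerProductSpace ℂ H] [CompleteSpace H]
  {σ : DensitySpectrum} {ℏ τ : ℝ} {A ρ : ℝ → H →L[ℂ] H} {ρ₀ ρ₁ : H →L[ℂ] H}

theorem curveLength_nonneg (hτ : 0 ≤ τ) (ρ : ℝ → H →L[ℂ] H) : 0 ≤ curveLength σ τ ρ :=
  intervalIntegral.integral_nonneg hτ fun _ _ => Real.sqrt_nonneg _

/-- Connectedness of the orbit is essential here: `sInf` of an empty set of reals is `0`, which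
would not be a greatest lower bound. -/
theorem isGLB_geodesicDist (hρ₀ : ρ₀ ∈ isospectral σ H) (hρ₁ : ρ₁ ∈ isospectral σ H) :
    IsGLB {L : ℝ | ∃ τ : ℝ, 0 < τ ∧ ∃ ρ : ℝ → H →L[ℂ] H,
      IsCurveIn σ ρ₀ ρ₁ τ ρ ∧ L = curveLength σ τ ρ} (geodesicDist σ ρ₀ ρ₁) := by
  obtain ⟨ρ, hρ⟩ := exists_isCurveIn hρ₀ hρ₁
  refine isGLB_csInf ⟨_, 1, one_pos, ρ, hρ, rfl⟩ ⟨0, ?_⟩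
  rintro _ ⟨τ, hτ, ρ, -, rfl⟩
  exact curveLength_nonneg hτ.le ρ

theorem geodesicDist_le_energyDispersion (hℏ : 0 < ℏ) (hτ : 0 < τ) (hρ₀ : ρ₀ ∈ isospectral σ H)
    (hρ₁ : ρ₁ ∈ isospectral σ H) (hA : IsHamiltonian τ A)
    (hρ : IsVonNeumannSolution ℏ τ A ρ₀ ρ₁ ρ) :
    geodesicDist σ ρ₀ ρ₁ ≤ energyDispersion ℏ τ A ρ :=
  ((isGLB_geodesicDist hρ₀ hρ₁).1
    ⟨τ, hτ, ρ, isCurveIn_of_isVonNeumannSolution hτ hA hρ hρ₀, rfl⟩).trans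
    (curveLength_le_energyDispersion hℏ hτ hA hρ hρ₀)

theorem buresLength_le_geodesicDist (hρ₀ : ρ₀ ∈ isospectral σ H) (hρ₁ : ρ₁ ∈ isospectral σ H) :
    buresLength ρ₀ ρ₁ ≤ geodesicDist σ ρ₀ ρ₁ := by
  refine (isGLB_geodesicDist hρ₀ hρ₁).2 ?_
  rintro _ ⟨τ, hτ, ρ, hρ, rfl⟩
  exact buresLength_le_curveLength hτ hρ

theorem exists_evolution_of_isCurveIn {τ' : ℝ} (hℏ : 0 < ℏ) (hτ : 0 < τ) (hτ' : 0 < τ')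
    (hρ : IsCurveIn σ ρ₀ ρ₁ τ' ρ) :
    ∃ A ρ' : ℝ → H →L[ℂ] H, IsHamiltonian τ A ∧ IsVonNeumannSolution ℏ τ A ρ₀ ρ₁ ρ' ∧
      curveLength σ τ' ρ = energyDispersion ℏ τ A ρ' := by
  obtain ⟨A, hA, hsol, -, hlen⟩ := exists_hamiltonian_of_isCurveIn hℏ hτ' hρ
  obtain ⟨A', ρ', hA', hsol', hE⟩ := exists_rescaled_evolution hτ' hτ hA hsol
  exact ⟨A', ρ', hA', hsol', hlen.trans hE.symm⟩

end Distance

end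

end QuantumSpeed

/-- The empty set has no greatest lower bound in `ℝ`, so each `IsGLB` also asserts that a
Hamiltonian joining the two states exists. -/
theorem theorem3 {H : Type*} [NormedAddCommGroup H] [InnerProductSpace ℂ H] [CompleteSpace H]
    (ℏ : ℝ) (hℏ : 0 < ℏ) (σ : QuantumSpeed.DensitySpectrum) (ρ₀ ρ₁ : H →L[ℂ] H)
    (hρ₀ : ρ₀ ∈ QuantumSpeed.isospectral σ H) (hρ₁ : ρ₁ ∈ QuantumSpeed.isospectral σ H) :
    -- the distance is the infimum of the energy dispersion integrals, for each evolution time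
    (∀ τ : ℝ, 0 < τ →
      IsGLB {E : ℝ | ∃ A ρ : ℝ → H →L[ℂ] H, QuantumSpeed.IsHamiltonian τ A ∧
          QuantumSpeed.IsVonNeumannSolution ℏ τ A ρ₀ ρ₁ ρ ∧
          E = QuantumSpeed.energyDispersion ℏ τ A ρ}
        (QuantumSpeed.geodesicDist σ ρ₀ ρ₁)) ∧
    -- and also over all evolution times together
    IsGLB {E : ℝ | ∃ τ : ℝ, 0 < τ ∧ ∃ A ρ : ℝ → H →L[ℂ] H, QuantumSpeed.IsHamiltonian τ A ∧
          QuantumSpeed.IsVonNeumannSolution ℏ τ A ρ₀ ρ₁ ρ ∧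
          E = QuantumSpeed.energyDispersion ℏ τ A ρ}
      (QuantumSpeed.geodesicDist σ ρ₀ ρ₁) ∧
    -- the speed limit, and its comparison with the one given by the Bures length
    (∀ (τ : ℝ) (A ρ : ℝ → H →L[ℂ] H), 0 < τ → QuantumSpeed.IsHamiltonian τ A →
      QuantumSpeed.IsVonNeumannSolution ℏ τ A ρ₀ ρ₁ ρ →
      0 < QuantumSpeed.averageUncertainty τ A ρ →
      τ ≥ ℏ / QuantumSpeed.averageUncertainty τ A ρ * QuantumSpeed.geodesicDist σ ρ₀ ρ₁ ∧
      ℏ / QuantumSpeed.averageUncertainty τ A ρ * QuantumSpeed.geodesicDist σ ρ₀ ρ₁ ≥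
        ℏ / QuantumSpeed.averageUncertainty τ A ρ * QuantumSpeed.buresLength ρ₀ ρ₁) := by
  have hglb := QuantumSpeed.isGLB_geodesicDist hρ₀ hρ₁
  refine ⟨fun τ hτ => ⟨?_, fun b hb => hglb.2 ?_⟩, ⟨?_, fun b hb => hglb.2 ?_⟩, ?_⟩
  · rintro _ ⟨A, ρ, hA, hρ, rfl⟩
    exact QuantumSpeed.geodesicDist_le_energyDispersion hℏ hτ hρ₀ hρ₁ hA hρ
  · rintro _ ⟨τ', hτ', ρ, hρ, rfl⟩
    obtain ⟨A, ρ', hA, hsol, hE⟩ := QuantumSpeed.exists_evolution_of_isCurveIn hℏ hτ hτ' hρ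
    exact hb ⟨A, ρ', hA, hsol, hE⟩
  · rintro _ ⟨τ, hτ, A, ρ, hA, hρ, rfl⟩
    exact QuantumSpeed.geodesicDist_le_energyDispersion hℏ hτ hρ₀ hρ₁ hA hρ
  · rintro _ ⟨τ', hτ', ρ, hρ, rfl⟩
    obtain ⟨A, ρ', hA, hsol, hE⟩ := QuantumSpeed.exists_evolution_of_isCurveIn hℏ hτ' hτ' hρ
    exact hb ⟨τ', hτ', A, ρ', hA, hsol, hE⟩
  · intro τ A ρ hτ hA hρ hE
    refine ⟨?_, mul_le_mul_of_nonneg_left (QuantumSpeed.buresLength_le_geodesicDist hρ₀ hρ₁)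
      (div_pos hℏ hE).le⟩
    have h := QuantumSpeed.geodesicDist_le_energyDispersion hℏ hτ hρ₀ hρ₁ hA hρ
    -- The dispersion is `τ ΔE / ħ`, so the speed limit is a rearrangement of distance ≤ dispersion.
    have h2 : QuantumSpeed.energyDispersion ℏ τ A ρ
        = τ * QuantumSpeed.averageUncertainty τ A ρ / ℏ := by
      unfold QuantumSpeed.energyDispersion QuantumSpeed.averageUncertainty
      field_simp
    rw [h2, le_div_iff₀ hℏ] at h
    rw [ge_iff_le, div_mul_eq_mul_div, div_le_iff₀ hE, mul_comm]
    exact h
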